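/- **Setting.** Let $m\in\mathbb R$ and let $\gamma^0,\dots,\gamma^3$ be complex $4\times4$ matrices with $\gamma^a\gamma^b+\gamma^b\gamma^a=2\eta^{ab}$, $\eta=\mathrm{diag}(1,-1,-1,-1)$. Repeated indices are summed, $j=1,2,3$, $a=0,\dots,3$. On (matrix-valued) tempered distributions on $\mathbb R^3$ put $\mathcal B=-\gamma^0\gamma^j\partial_j-im\gamma^0$. Let $$\triangle(t,\vec x)=\int d\Gamma_p\left(e^{-iE_pt+i\vec p\vec x}-e^{iE_pt-i\vec p\vec x}\right),\qquad d\Gamma_p=\frac{d^3p}{(2\pi)^32E_p},\quad E_p=\sqrt{\vec p^{\,2}+m^2},$$ be the Pauli–Jordan function, regarded as a tempered distribution in $\vec x$ for every $t$. For a test function $\varphi\in\mathcal S(\mathbb R^3)$ write $\hat\varphi(\vec p)=\int e^{i\vec p\vec x}\varphi(\vec x)\,d^3x$. Below, $\partial_0$ is the derivative with respect to the time argument of $\triangle$. **Theorem.** 1. For every $\varphi\in\mathcal S(\mathbb R^3)$ the function $t\mapsto\langle\triangle(t,\cdot),\varphi\rangle$ is $C^\infty$, and for every $k\in\mathbb N$,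 with time derivatives $\triangle^{(n)}$, $$(\partial_j\partial_j-m^2)^k\delta=i\triangle^{(2k+1)}(0,\cdot).$$ 2. $\mathcal B^2=\partial_j\partial_j-m^2$. 3. The identity $$-i\sum_{n=0}^\infty\frac{\tau^n}{n!}\mathcal B^n\delta(\vec x)\gamma^0=-i\,(i\gamma^a\partial_a+m)\triangle(\tau,\vec x)$$ holds in the following sense. For every $\varphi\in\mathcal S(\mathbb R^3)$ the right-hand side paired with $\varphi$ is $C^\infty$ in $\tau$, and the left-hand side paired with $\varphi$ is its Taylor series at $\tau=0$. For every $\tau\in\mathbb R$ and every $\varphi$ for which $e^{|\tau||\vec p|}\hat\varphi(\vec p)$ is integrable (for instance every $\varphi$ with compactly supported Fourier transform) the series paired with $\varphi$ converges absolutely to the right-hand side paired with $\varphi$. 4. Consider the classical Dirac field with odd canonical variables $\psi,\overline\psi,\pi,\overline\pi$, the generalized Poisson bracket with $[\psi_l(\vec x),\pi_{l'}(\vec x')]_{GP}=\delta_{ll'}\delta(\vec x-\vec x')$, $[\overline\psi_l(\vec x),\overline\pi_{l'}(\vec x')]_{GP}=-\delta_{ll'}\delta(\vec x-\vec x')$ and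 the other brackets of these variables zero (up to symmetry), the constraints $\chi_1=\pi-\frac i2\overline\psi\gamma^0$, $\chi_2=\overline\pi+\frac i2\gamma^0\psi$, the Hamiltonian $$H'=\int\left(\overline\psi(-i\gamma^j\partial_j+m)\psi+\chi_1U^1+U^2\chi_2\right)d^3x,\quad U^1=-\gamma^0\gamma^j\partial_j\psi-im\gamma^0\psi,\quad U^2=-\partial_j\overline\psi\gamma^j\gamma^0+im\overline\psi\gamma^0,$$ and the generalized Dirac bracket $[F,G]_{GD}=[F,G]_{GP}-[F,\chi_\beta]_{GP}C^{\beta\beta'}[\chi_{\beta'},G]_{GP}$, where $C^{\beta\beta'}$ is the inverse of $[\chi_\beta,\chi_{\beta'}]_{GP}$. Let $\psi^{(n)}$ be the $n$-th time derivative of $\psi$ generated by $\dot F=[F,H']_{GP}$. Then, smeared with arbitrary Schwartz functions $f(\vec x')$, $g(\vec x)$, for every $n$ $$[\psi^{(n)}_{l'}(\vec x'),\overline\psi_l(\vec x)]_{GD}=-i\left(\mathcal B^n\delta(\vec x'-\vec x)\gamma^0\right)_{l'l}.$$ If moreover $e^{|\tau||\vec p|}\hat f(\vec p)$ is integrable,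 then the series defining the non-equal-time bracket converges absolutely, and, smeared with $f$ and $g$, $$\sum_{n=0}^\infty\frac{\tau^n}{n!}[\psi^{(n)}_{l'}(\vec x'),\overline\psi_l(\vec x)]_{GD}=-i\left((i\gamma^a\partial_a+m)\triangle\right)_{l'l}(\tau,\vec x'-\vec x).$$ 5. Consider any quantization of this system on a Hilbert space: operators $\widehat F(t)$, linear in the linear functionals $F$ of the canonical fields smeared with Schwartz functions, with $[\widehat F(t),\widehat G(t)]_+=i[F,G]_{GD}$ at equal times, with $\frac{d}{dt}\widehat F=\widehat{[F,H']_{GP}}$ in the sense of matrix elements, and with $\widehat{\overline\psi}=\widehat\psi^\dagger\gamma^0$. Then for all space–time points $x=(t,\vec x)$ and $x'=(t',\vec x')$, smeared with arbitrary Schwartz functions of $\vec x$ and $\vec x'$, $$[\widehat\psi_l(x),\widehat{\overline\psi}_{l'}(x')]_+=(i\gamma^a\partial_a+m)_{ll'}\triangle(x-x').$$ -/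

import Mathlib

open MeasureTheory SchwartzMap FourierTransform LineDeriv

noncomputable section

namespace DiracField

/-! ### The Pauli-Jordan function -/

/-- Physical space. -/
abbrev Space : Type := EuclideanSpace ℝ (Fin 3)

/-- `E_p = √(p² + m²)`. -/
def energy (m : ℝ) (p : Space) : ℝ := Real.sqrt (‖p‖ ^ 2 + m ^ 2)

/-- `e^{i p·x}`. -/
def planeWave (p x : Space) : ℂ := Complex.exp (Complex.I * (inner ℝ p x : ℝ))

/-- The density of `dΓ_p = d³p / ((2π)³ 2 E_p)` with respect to `d³p`. -/
def massShellDensity (m : ℝ) (p : Space) : ℝ := 1 / ((2 * Real.pi) ^ 3 * (2 * energy m p))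

/-- The Pauli-Jordan function `∫ dΓ_p (e^{-iE_p t} e^{ip·x} - e^{iE_p t} e^{-ip·x})` at time `t`,
as an oscillatory integral in `p`, paired with a test function `φ` of `x`. -/
def pauliJordanIntegral (m t : ℝ) (φ : 𝓢(Space, ℂ)) : ℂ :=
  ∫ p : Space, (massShellDensity m p : ℂ) * ∫ x : Space,
    (Complex.exp (-(Complex.I * energy m p * t)) * planeWave p x
      - Complex.exp (Complex.I * energy m p * t) * planeWave (-p) x) * φ x

theorem continuous_energy (m : ℝ) : Continuous (energy m) := by
  unfold energy; fun_prop

theorem measurable_massShellDensity (m : ℝ) : Measurable (massShellDensity m) := by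
  unfold massShellDensity
  exact measurable_const.div (measurable_const.mul
    (measurable_const.mul (continuous_energy m).measurable))

theorem massShellDensity_nonneg (m : ℝ) (p : Space) : 0 ≤ massShellDensity m p := by
  unfold massShellDensity energy; positivity

theorem massShellDensity_le (m : ℝ) {p : Space} (hp : p ≠ 0) :
    massShellDensity m p ≤ ‖p‖⁻¹ := by
  have h0 : 0 < ‖p‖ := norm_pos_iff.mpr hp
  have h1 : ‖p‖ ≤ energy m p := Real.le_sqrt_of_sq_le (by nlinarith [sq_nonneg m])
  have h2 : (1 : ℝ) ≤ (2 * Real.pi) ^ 3 :=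
    one_le_pow₀ (by nlinarith [Real.pi_gt_three])
  unfold massShellDensity
  rw [one_div]
  apply inv_anti₀ h0
  nlinarith [mul_le_mul h2 h1 h0.le (by positivity)]

theorem integrable_massShellDensity (m : ℝ) :
    Integrable (fun p : Space => massShellDensity m p * (1 + ‖p‖) ^ (-(4 : ℝ))) := by
  have hae : ∀ᵐ p : Space, p ≠ 0 := by
    simp [ae_iff]
  have hm : AEStronglyMeasurable
      (fun p : Space => massShellDensity m p * (1 + ‖p‖) ^ (-(4 : ℝ))) volume :=
    ((measurable_massShellDensity m).mul (by fun_prop)).aestronglyMeasurable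
  have hle : ∀ p : Space, (1 + ‖p‖) ^ (-(4 : ℝ)) ≤ 1 := fun p =>
    Real.rpow_le_one_of_one_le_of_nonpos (by linarith [norm_nonneg p]) (by norm_num)
  rw [← integrableOn_univ, ← Set.union_compl_self (Metric.ball (0 : Space) 1)]
  apply IntegrableOn.union
  · apply integrableOn_ball_of_norm_le_rpow (C := 1) (α := 1) (by simp) (by simp) ?_ hm
    filter_upwards [ae_restrict_of_ae hae] with p hp
    have h0 := massShellDensity_nonneg m p
    have h1 : (0 : ℝ) ≤ (1 + ‖p‖) ^ (-(4 : ℝ)) := by positivity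
    rw [Real.norm_of_nonneg (mul_nonneg h0 h1), Real.rpow_neg_one, one_mul]
    calc _ ≤ massShellDensity m p * 1 := by gcongr; exact hle p
      _ ≤ _ := by rw [mul_one]; exact massShellDensity_le m hp
  · have h4 : Integrable (fun p : Space => (1 + ‖p‖) ^ (-(4 : ℝ))) :=
      integrable_one_add_norm (by simp; norm_num)
    refine Integrable.mono' h4.integrableOn hm.restrict ?_
    rw [ae_restrict_iff' Metric.isOpen_ball.measurableSet.compl]
    filter_upwards [hae] with p hp hpb
    have h0 := massShellDensity_nonneg m p
    have h1 : (0 : ℝ) ≤ (1 + ‖p‖) ^ (-(4 : ℝ)) := by positivity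
    rw [Real.norm_of_nonneg (mul_nonneg h0 h1)]
    have h3 : (1 : ℝ) ≤ ‖p‖ := by simpa using hpb
    have : massShellDensity m p ≤ 1 :=
      (massShellDensity_le m hp).trans (inv_le_one_of_one_le₀ h3)
    nlinarith

theorem integrable_density_mul (m : ℝ) (h : Space → ℂ) (hh : Measurable h)
    (hb : ∀ p, ‖h p‖ ≤ 1) (ψ : 𝓢(Space, ℂ)) :
    Integrable (fun p => (massShellDensity m p : ℂ) * (h p * ψ p)) ∧
    ‖∫ p, (massShellDensity m p : ℂ) * (h p * ψ p)‖ ≤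
      (2 ^ 4 * ∫ p : Space, massShellDensity m p * (1 + ‖p‖) ^ (-(4 : ℝ))) *
      (Finset.Iic ((4, 0) : ℕ × ℕ)).sup (schwartzSeminormFamily ℂ Space ℂ) ψ := by
  set S := (Finset.Iic ((4, 0) : ℕ × ℕ)).sup (schwartzSeminormFamily ℂ Space ℂ) ψ with hS
  have key : ∀ p, ‖(massShellDensity m p : ℂ) * (h p * ψ p)‖ ≤
      2 ^ 4 * S * (massShellDensity m p * (1 + ‖p‖) ^ (-(4 : ℝ))) := by
    intro p
    have h0 := massShellDensity_nonneg m p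
    have h1 := one_add_le_sup_seminorm_apply (𝕜 := ℂ) (m := (4, 0)) (k := 4) (n := 0)
      le_rfl le_rfl ψ p
    rw [norm_iteratedFDeriv_zero] at h1
    have hpos : (0 : ℝ) < 1 + ‖p‖ := by positivity
    have h2 : ‖ψ p‖ ≤ 2 ^ 4 * S * (1 + ‖p‖) ^ (-(4 : ℝ)) := by
      rw [Real.rpow_neg hpos.le, ← div_eq_mul_inv, le_div_iff₀ (by positivity), mul_comm]
      norm_cast
      norm_cast at h1
    rw [norm_mul, norm_mul, Complex.norm_real, Real.norm_of_nonneg h0]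
    calc _ ≤ massShellDensity m p * (1 * (2 ^ 4 * S * (1 + ‖p‖) ^ (-(4 : ℝ)))) := by
          gcongr; exact hb p
      _ = _ := by ring
  have hint := (integrable_massShellDensity m).const_mul (2 ^ 4 * S)
  refine ⟨hint.mono' ?_ (.of_forall key), ?_⟩
  · exact ((Complex.measurable_ofReal.comp (measurable_massShellDensity m)).mul
      (hh.mul ψ.continuous.measurable)).aestronglyMeasurable
  · refine (norm_integral_le_of_norm_le hint (.of_forall key)).trans (le_of_eq ?_)
    rw [integral_const_mul]; ring

/-- The functional `ψ ↦ ∫ h ψ dΓ` for a bounded measurable `h`. -/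
def densityCLM (m : ℝ) (h : Space → ℂ) (hh : Measurable h) (hb : ∀ p, ‖h p‖ ≤ 1) :
    𝓢(Space, ℂ) →L[ℂ] ℂ :=
  mkCLMtoNormedSpace (fun ψ => ∫ p, (massShellDensity m p : ℂ) * (h p * ψ p))
    (fun f g => by
      rw [← integral_add (integrable_density_mul m h hh hb f).1
        (integrable_density_mul m h hh hb g).1]
      congr 1; ext p; simp; ring)
    (fun a f => by
      rw [RingHom.id_apply, smul_eq_mul, ← integral_const_mul]
      congr 1; ext p; simp; ring)
    ⟨_, _, mul_nonneg (by norm_num) (integral_nonneg fun p =>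
        mul_nonneg (massShellDensity_nonneg m p) (by positivity)),
      fun f => (integrable_density_mul m h hh hb f).2⟩

theorem densityCLM_apply (m : ℝ) (h : Space → ℂ) (hh : Measurable h) (hb : ∀ p, ‖h p‖ ≤ 1)
    (ψ : 𝓢(Space, ℂ)) :
    densityCLM m h hh hb ψ = ∫ p, (massShellDensity m p : ℂ) * (h p * ψ p) := rfl

/-- Dilation of Schwartz functions, `φ ↦ φ (c ·)`. -/
def scaleCLM (c : ℝ) (hc : c ≠ 0) : 𝓢(Space, ℂ) →L[ℂ] 𝓢(Space, ℂ) :=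
  compCLMOfContinuousLinearEquiv ℂ (ContinuousLinearEquiv.smulLeft (Units.mk0 c hc))

theorem scaleCLM_apply (c : ℝ) (hc : c ≠ 0) (φ : 𝓢(Space, ℂ)) (p : Space) :
    scaleCLM c hc φ p = φ (c • p) := rfl

theorem integral_planeWave (c : ℝ) (hc : 2 * Real.pi * c = -1) (φ : 𝓢(Space, ℂ)) (p : Space) :
    ∫ x, planeWave p x * φ x = 𝓕 φ (c • p) := by
  rw [fourier_coe, Real.fourier_eq']
  congr 1; ext x
  rw [smul_eq_mul, planeWave, inner_smul_right, real_inner_comm p x]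
  congr 2
  have : (2 * Real.pi * c : ℂ) = -1 := by exact_mod_cast hc
  push_cast
  linear_combination (Complex.I * (inner ℝ p x : ℝ)) * this

/-- `e^{i E_p s}`. -/
def phase (m s : ℝ) (p : Space) : ℂ := Complex.exp (Complex.I * energy m p * s)

theorem measurable_phase (m s : ℝ) : Measurable (phase m s) := by
  have := continuous_energy m
  unfold phase
  exact Continuous.measurable (by fun_prop)

theorem norm_phase (m s : ℝ) (p : Space) : ‖phase m s p‖ ≤ 1 := by
  unfold phase
  rw [mul_assoc, mul_comm, ← Complex.ofReal_mul, Complex.norm_exp_ofReal_mul_I]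


/-- A manifestly continuous form of `pauliJordanIntegral`. -/
def pauliJordanCLM (m t : ℝ) : 𝓢(Space, ℂ) →L[ℂ] ℂ :=
  (densityCLM m (phase m (-t)) (measurable_phase m _) (norm_phase m _) ∘L
    scaleCLM (-(2 * Real.pi)⁻¹) (by simp [Real.pi_ne_zero])
  - densityCLM m (phase m t) (measurable_phase m _) (norm_phase m _) ∘L
    scaleCLM (2 * Real.pi)⁻¹ (by simp [Real.pi_ne_zero])) ∘L fourierCLM ℂ 𝓢(Space, ℂ)

theorem integrable_planeWave_mul (p : Space) (φ : 𝓢(Space, ℂ)) :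
    Integrable (fun x => planeWave p x * φ x) := by
  refine φ.integrable.norm.mono' ?_ (.of_forall fun x => ?_)
  · have : Continuous (planeWave p) := by unfold planeWave; fun_prop
    exact (this.mul φ.continuous).aestronglyMeasurable
  · rw [norm_mul, planeWave, mul_comm Complex.I, Complex.norm_exp_ofReal_mul_I, one_mul]

theorem pauliJordanIntegral_eq (m t : ℝ) (φ : 𝓢(Space, ℂ)) :
    pauliJordanIntegral m t φ = pauliJordanCLM m t φ := by
  have hpi : (2 * Real.pi) ≠ 0 := by simp [Real.pi_ne_zero]
  have h1 := fun p => integral_planeWave (-(2 * Real.pi)⁻¹) (by field_simp) φ p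
  have hx : ∀ p, ∫ x : Space, (Complex.exp (-(Complex.I * energy m p * t)) * planeWave p x
      - Complex.exp (Complex.I * energy m p * t) * planeWave (-p) x) * φ x
      = phase m (-t) p * 𝓕 φ (-(2 * Real.pi)⁻¹ • p)
        - phase m t p * 𝓕 φ ((2 * Real.pi)⁻¹ • p) := by
    intro p
    have h2 := h1 (-p)
    rw [smul_neg, neg_smul, neg_neg] at h2
    rw [← h1 p, ← h2, ← integral_const_mul, ← integral_const_mul, ← integral_sub]
    · congr 1; ext x; simp [phase]; ring
    · exact (integrable_planeWave_mul p φ).const_mul _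
    · exact (integrable_planeWave_mul (-p) φ).const_mul _
  have hA := integrable_density_mul m _ (measurable_phase m (-t)) (norm_phase m (-t))
    (scaleCLM (-(2 * Real.pi)⁻¹) (by simp [Real.pi_ne_zero]) (𝓕 φ))
  have hB := integrable_density_mul m _ (measurable_phase m t) (norm_phase m t)
    (scaleCLM (2 * Real.pi)⁻¹ (by simp [Real.pi_ne_zero]) (𝓕 φ))
  simp only [scaleCLM_apply] at hA hB
  simp only [pauliJordanIntegral, hx, mul_sub, pauliJordanCLM, sub_apply,
    ContinuousLinearMap.comp_apply, densityCLM_apply, scaleCLM_apply, fourierCLM_apply]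
  exact integral_sub hA.1 hB.1

/-- The Pauli-Jordan function `△(t, ·)` as a tempered distribution on space. -/
def pauliJordan (m t : ℝ) : 𝓢'(Space, ℂ) :=
  ContinuousLinearMap.toPointwiseConvergenceCLM _ _ _ _
    { toFun := pauliJordanIntegral m t
      map_add' := fun f g => by simp [pauliJordanIntegral_eq]
      map_smul' := fun c f => by simp [pauliJordanIntegral_eq]
      cont := by
        have h : pauliJordanIntegral m t = pauliJordanCLM m t :=
          funext (pauliJordanIntegral_eq m t)
        rw [h]; exact (pauliJordanCLM m t).continuous }

/-! ### Dirac matrices and the operator `𝓑` -/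

/-- Complex `4 × 4` matrices. -/
abbrev Mat : Type := Matrix (Fin 4) (Fin 4) ℂ

/-- The defining relation `γ^a γ^b + γ^b γ^a = 2 η^{ab}` of the Dirac matrices, with
`η = diag(1, -1, -1, -1)`. -/
def IsDiracMatrices (γ : Fin 4 → Mat) : Prop :=
  ∀ a b : Fin 4, γ a * γ b + γ b * γ a =
    (2 * (Matrix.diagonal ![1, -1, -1, -1] : Mat) a b) • (1 : Mat)

/-- The unit vector along the `j`-th spatial axis. -/
def axis (j : Fin 3) : Space := EuclideanSpace.single j 1

/-- Matrices of tempered distributions on space. -/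
abbrev MatDistribution : Type := Matrix (Fin 4) (Fin 4) 𝓢'(Space, ℂ)

/-- `𝓑 = -γ⁰ γ^j ∂_j - i m γ⁰`, acting from the left on a matrix of distributions. -/
def diracB (γ : Fin 4 → Mat) (m : ℝ) (T : MatDistribution) : MatDistribution := fun i k =>
  -(∑ j : Fin 3, ∑ l : Fin 4, (γ 0 * γ j.succ) i l • ∂_{axis j} (T l k))
    - (Complex.I * m) • ∑ l : Fin 4, γ 0 i l • T l k

/-- `T M` for a matrix of distributions `T` and a constant matrix `M`. -/
def mulConst (T : MatDistribution) (M : Mat) : MatDistribution := fun i k =>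
  ∑ l : Fin 4, M l k • T i l

/-- The Dirac delta at the origin times the unit matrix. -/
def deltaMat : MatDistribution := Matrix.diagonal fun _ => TemperedDistribution.delta (0 : Space)

/-- The Klein-Gordon operator `∂_j ∂_j - m²` on tempered distributions. -/
def kleinGordon (m : ℝ) (T : 𝓢'(Space, ℂ)) : 𝓢'(Space, ℂ) :=
  (∑ j : Fin 3, ∂_{axis j} (∂_{axis j} T)) - ((m : ℂ) ^ 2) • T

/-- The `(i, k)` entry of `(i γ^a ∂_a + m) △(τ, ·)`, paired with the test function `φ`; here
`∂_0` is the derivative with respect to `τ`. -/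
def diracPauliJordan (γ : Fin 4 → Mat) (m τ : ℝ) (i k : Fin 4) (φ : 𝓢(Space, ℂ)) : ℂ :=
  Complex.I * (γ 0 i k * deriv (fun t : ℝ => pauliJordan m t φ) τ
      + ∑ j : Fin 3, γ j.succ i k * (∂_{axis j} (pauliJordan m τ)) φ)
    + m * (1 : Mat) i k * pauliJordan m τ φ

/-- `e^{r |p|} φ̂(p)` is integrable, where `φ̂(p) = ∫ e^{i p·x} φ(x) d³x`. -/
def ExpDecay (r : ℝ) (φ : 𝓢(Space, ℂ)) : Prop :=
  Integrable fun p : Space => (Real.exp (r * ‖p‖) : ℂ) * ∫ x : Space, planeWave p x * φ x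

/-- `∫∫ T(x' - x) f(x') g(x) d³x' d³x` for a distribution `T`. -/
def smearDiff (T : 𝓢(Space, ℂ) → ℂ) (f g : 𝓢(Space, ℂ)) : ℂ :=
  ∫ x : Space, g x * T (compSubConstCLM ℂ (-x) f)

/-! ### The phase space of the Dirac field

The canonical fields at a fixed time are the odd fields `ψ`, `π̄` (columns) and `ψ̄`, `π` (rows).
The dynamical variables that occur are linear functionals of the fields (odd) and bilinear
functionals built from one row and one column field (even), such as the Hamiltonian. -/

/-- Four-component test functions. -/
abbrev TestSpinor : Type := Fin 4 → 𝓢(Space, ℂ)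

/-- The row fields. -/
inductive Row : Type
  | psibar
  | pi

/-- The column fields. -/
inductive Col : Type
  | psi
  | pibar

/-- An odd linear functional
`F = ∫ (ψ̄ F₁(ψ̄) + π F₁(π) + F₂(ψ) ψ + F₂(π̄) π̄) d³x`. The coefficients are its functional
derivatives: left derivatives for `ψ̄`, `π`, right derivatives for `ψ`, `π̄`. -/
abbrev LinFun : Type := (Row → TestSpinor) × (Col → TestSpinor)

/-- `ψ_l(f) = ∫ ψ_l(x) f(x) d³x`. -/
def psiField (l : Fin 4) (f : 𝓢(Space, ℂ)) : LinFun :=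
  (0, fun
    | .psi => Pi.single l f
    | .pibar => 0)

/-- `ψ̄_l(f) = ∫ ψ̄_l(x) f(x) d³x`. -/
def psibarField (l : Fin 4) (f : 𝓢(Space, ℂ)) : LinFun :=
  (fun
    | .psibar => Pi.single l f
    | .pi => 0, 0)

/-- `∫ ∑_l f_l g_l d³x`. -/
def spinorPairing (f g : TestSpinor) : ℂ := ∫ x : Space, ∑ l : Fin 4, f l x * g l x

/-- The generalized Poisson bracket of two odd linear functionals,
`∫ (δF/δψ δG/δπ - δG/δπ̄ δF/δψ̄ + δG/δψ δF/δπ - δF/δπ̄ δG/δψ̄) d³x`. -/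
def gpb (F G : LinFun) : ℂ :=
  spinorPairing (F.2 .psi) (G.1 .pi) - spinorPairing (G.2 .pibar) (F.1 .psibar)
    + spinorPairing (G.2 .psi) (F.1 .pi) - spinorPairing (F.2 .pibar) (G.1 .psibar)

/-- At most one spatial derivative: `none` is the identity and `some j` is `∂_j`. -/
def pd : Option (Fin 3) → 𝓢(Space, ℂ) → 𝓢(Space, ℂ)
  | none, f => f
  | some j, f => ∂_{axis j} f

/-- The sign from one integration by parts. -/
def pdSign : Option (Fin 3) → ℂ
  | none => 1
  | some _ => -1

/-- A local row expression `∑ ∂_a R(x) M_{R,a}` in the row fields `R`. -/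
abbrev RowExpr : Type := Row → Option (Fin 3) → Mat

/-- A local column expression `∑ M_{C,a} ∂_a C(x)` in the column fields `C`. -/
abbrev ColExpr : Type := Col → Option (Fin 3) → Mat

/-- An even functional `∫ ∑ ∂_a R M_{R,C,a,b} ∂_b C d³x` of row fields `R` and column
fields `C`. -/
abbrev QuadFun : Type := Row → Col → Option (Fin 3) → Option (Fin 3) → Mat

/-- The even functional `∫ ρ(x) κ(x) d³x`. -/
def quadOf (ρ : RowExpr) (κ : ColExpr) : QuadFun := fun R C a b => ρ R a * κ C b

/-- `∫ u δE/δR d³x` for a test row `u`, as a linear functional of the column fields. -/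
def dRow (E : QuadFun) (R : Row) (u : TestSpinor) : Col → TestSpinor := fun C k =>
  ∑ a, ∑ b, pdSign b • ∑ l : Fin 4, E R C a b l k • pd b (pd a (u l))

/-- `∫ δE/δC u d³x` for a test column `u`, as a linear functional of the row fields. -/
def dCol (E : QuadFun) (C : Col) (u : TestSpinor) : Row → TestSpinor := fun R l =>
  ∑ a, ∑ b, pdSign a • ∑ k : Fin 4, E R C a b l k • pd a (pd b (u k))

/-- The generalized Poisson bracket of an odd linear `F` and an even `E`,
`∫ (δF/δψ δE/δπ + δE/δπ̄ δF/δψ̄ - δE/δψ δF/δπ - δF/δπ̄ δE/δψ̄) d³x`. -/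
def gpbEven (F : LinFun) (E : QuadFun) : LinFun :=
  (dCol E .pibar (F.1 .psibar) - dCol E .psi (F.1 .pi),
    dRow E .pi (F.2 .psi) - dRow E .psibar (F.2 .pibar))

/-! ### Constraints, Hamiltonian and the generalized Dirac bracket -/

/-- The constraint `χ₁ = π - (i/2) ψ̄ γ⁰`. -/
def chi1 (γ : Fin 4 → Mat) : RowExpr
  | .pi, none => 1
  | .psibar, none => -(Complex.I / 2) • γ 0
  | _, some _ => 0

/-- The constraint `χ₂ = π̄ + (i/2) γ⁰ ψ`. -/
def chi2 (γ : Fin 4 → Mat) : ColExpr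
  | .pibar, none => 1
  | .psi, none => (Complex.I / 2) • γ 0
  | _, some _ => 0

/-- The field `ψ̄`. -/
def psibarExpr : RowExpr
  | .psibar, none => 1
  | _, _ => 0

/-- `(-i γ^j ∂_j + m) ψ`. -/
def energyExpr (γ : Fin 4 → Mat) (m : ℝ) : ColExpr
  | .psi, some j => -Complex.I • γ j.succ
  | .psi, none => (m : ℂ) • 1
  | .pibar, _ => 0

/-- `U¹ = -γ⁰ γ^j ∂_j ψ - i m γ⁰ ψ`. -/
def multiplier1 (γ : Fin 4 → Mat) (m : ℝ) : ColExpr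
  | .psi, some j => -(γ 0 * γ j.succ)
  | .psi, none => -(Complex.I * m) • γ 0
  | .pibar, _ => 0

/-- `U² = -∂_j ψ̄ γ^j γ⁰ + i m ψ̄ γ⁰`. -/
def multiplier2 (γ : Fin 4 → Mat) (m : ℝ) : RowExpr
  | .psibar, some j => -(γ j.succ * γ 0)
  | .psibar, none => (Complex.I * m) • γ 0
  | .pi, _ => 0

/-- The first class Hamiltonian
`H' = ∫ (ψ̄ (-i γ^j ∂_j + m) ψ + χ₁ U¹ + U² χ₂) d³x` of the Dirac field. -/
def hamiltonian (γ : Fin 4 → Mat) (m : ℝ) : QuadFun :=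
  quadOf psibarExpr (energyExpr γ m) + quadOf (chi1 γ) (multiplier1 γ m)
    + quadOf (multiplier2 γ m) (chi2 γ)

/-- The `n`-th time derivative of `F` that `Ḟ = [F, H']` generates. -/
def timeDeriv (γ : Fin 4 → Mat) (m : ℝ) (n : ℕ) (F : LinFun) : LinFun :=
  (fun G => gpbEven G (hamiltonian γ m))^[n] F

/-- The functions `x ↦ [F, R_l(x)]_GP` for a row field `R`. -/
def gpbRow (F : LinFun) : Row → TestSpinor
  | .psibar => -F.2 .pibar
  | .pi => F.2 .psi

/-- The functions `x ↦ [F, C_l(x)]_GP` for a column field `C`. -/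
def gpbCol (F : LinFun) : Col → TestSpinor
  | .psi => F.1 .pi
  | .pibar => -F.1 .psibar

/-- The functions `x ↦ [F, ρ_l(x)]_GP = [ρ_l(x), F]_GP` for a row expression `ρ`. -/
def gpbRowExpr (F : LinFun) (ρ : RowExpr) : TestSpinor := fun l =>
  ∑ a, ∑ k : Fin 4, (ρ .psibar a k l • pd a (gpbRow F .psibar k)
    + ρ .pi a k l • pd a (gpbRow F .pi k))

/-- The functions `x ↦ [F, κ_l(x)]_GP = [κ_l(x), F]_GP` for a column expression `κ`. -/
def gpbColExpr (F : LinFun) (κ : ColExpr) : TestSpinor := fun l =>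
  ∑ a, ∑ k : Fin 4, (κ .psi a l k • pd a (gpbCol F .psi k)
    + κ .pibar a l k • pd a (gpbCol F .pibar k))

/-- The smeared constraint `∫ χ₁ f d³x`. -/
def chi1Smeared (γ : Fin 4 → Mat) (f : TestSpinor) : LinFun :=
  (fun R l => ∑ k : Fin 4, chi1 γ R none l k • f k, 0)

/-- The smeared constraint `∫ f χ₂ d³x`. -/
def chi2Smeared (γ : Fin 4 → Mat) (f : TestSpinor) : LinFun :=
  (0, fun C k => ∑ l : Fin 4, chi2 γ C none l k • f l)

/-- The matrix `c` in `[χ_{1l}(x), χ_{2l'}(x')]_GP = c_{ll'} δ(x - x')`. The brackets of `χ₁` with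
`χ₁` and of `χ₂` with `χ₂` vanish. -/
def constraintMatrix (γ : Fin 4 → Mat) : Mat := fun l l' => Complex.I * γ 0 l' l

theorem gpb_chi1_chi2 (γ : Fin 4 → Mat) (f g : TestSpinor) :
    gpb (chi1Smeared γ f) (chi2Smeared γ g) =
      ∫ x : Space, ∑ l, ∑ l', constraintMatrix γ l l' * (f l x * g l' x) := by
  have hf : ∀ l l' : Fin 4, Integrable fun x => f l x * g l' x := fun l l' =>
    ((pairing (ContinuousLinearMap.mul ℂ ℂ)) (f l) (g l')).integrable
  simp only [gpb, chi1Smeared, chi2Smeared, spinorPairing, chi1, chi2, constraintMatrix]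
  simp [Fin.sum_univ_four, Matrix.one_apply]
  rw [← integral_neg, ← integral_add]
  · congr 1; ext x; ring
  · have h : Integrable fun x => ∑ l, ∑ l', (Complex.I / 2 * γ 0 l' l) * (f l x * g l' x) :=
      integrable_finsetSum _ fun l _ => integrable_finsetSum _ fun l' _ => (hf l l').const_mul _
    refine h.congr (.of_forall fun x => ?_)
    simp [Fin.sum_univ_four]; ring
  · have h : Integrable fun x => ∑ l, ∑ l', (Complex.I / 2 * γ 0 l' l) * (f l x * g l' x) :=
      integrable_finsetSum _ fun l _ => integrable_finsetSum _ fun l' _ => (hf l l').const_mul _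
    refine h.congr (.of_forall fun x => ?_)
    simp [Fin.sum_univ_four]; ring

theorem gpb_chi1_chi1 (γ : Fin 4 → Mat) (f g : TestSpinor) :
    gpb (chi1Smeared γ f) (chi1Smeared γ g) = 0 := by
  simp [gpb, chi1Smeared, spinorPairing]

theorem gpb_chi2_chi2 (γ : Fin 4 → Mat) (f g : TestSpinor) :
    gpb (chi2Smeared γ f) (chi2Smeared γ g) = 0 := by
  simp [gpb, chi2Smeared, spinorPairing]

/-- The generalized Dirac bracket `[F, G]_GP - [F, χ_β]_GP C^{ββ'} [χ_β', G]_GP` of two odd linear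
functionals. The inverse `C^{ββ'}` of the matrix of brackets of the constraints is
`C^{1lx,2l'x'} = C^{2l'x',1lx} = (c⁻¹)_{l'l} δ(x - x')`. -/
def gdb (γ : Fin 4 → Mat) (F G : LinFun) : ℂ :=
  gpb F G - ∑ l : Fin 4, ∑ l' : Fin 4, (constraintMatrix γ)⁻¹ l' l * ∫ x : Space,
    (gpbRowExpr F (chi1 γ) l x * gpbColExpr G (chi2 γ) l' x
      + gpbColExpr F (chi2 γ) l' x * gpbRowExpr G (chi1 γ) l x)

/-! ### Quantization -/

/-- The complex conjugate of a test function. -/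
def conjTest (f : 𝓢(Space, ℂ)) : 𝓢(Space, ℂ) :=
  postcompCLM (𝕜 := ℝ) (Complex.conjCLE : ℂ →L[ℝ] ℂ) f

/-- A quantized Dirac field on a Hilbert space `𝓗`: to every odd linear functional `F` and time `t`
an operator `op t F`, linearly in `F`, such that equal-time anticommutators are `i` times
generalized Dirac brackets, matrix elements evolve by `Ḟ = [F, H']`, and `ψ̄ = ψ† γ⁰`. -/
structure QuantizedDiracField (γ : Fin 4 → Mat) (m : ℝ) (𝓗 : Type*)
    [NormedAddCommGroup 𝓗] [InnerProductSpace ℂ 𝓗] [CompleteSpace 𝓗] where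
  /-- The operator of `F` at time `t`. -/
  op : ℝ → LinFun →ₗ[ℂ] (𝓗 →L[ℂ] 𝓗)
  anticomm : ∀ (t : ℝ) (F G : LinFun),
    op t F * op t G + op t G * op t F = (Complex.I * gdb γ F G) • 1
  evolution : ∀ (F : LinFun) (u v : 𝓗) (t : ℝ),
    HasDerivAt (fun s : ℝ => inner ℂ u (op s F v))
      (inner ℂ u (op t (timeDeriv γ m 1 F) v)) t
  dirac_conj : ∀ (t : ℝ) (l : Fin 4) (f : 𝓢(Space, ℂ)),
    op t (psibarField l f) =
      ∑ k : Fin 4, γ 0 k l • ContinuousLinearMap.adjoint (op t (psiField k (conjTest f)))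

end DiracField

end

/-!
After the Fourier transform `φ̂(p) = ∫ e^{ip·x} φ(x) d³x` the Pauli-Jordan function `△(t, ·)` has
the symbol `-i sin(E_p t) / E_p` and its time derivative has the symbol `-i cos(E_p t)`
(`pauliJordan_eq_sinFunctional`, `hasDerivAt_sinFunctional`, `hasDerivAt_cosFunctional`). Hence `△`
solves the Klein-Gordon equation with `△(0, ·) = 0` and `∂_0 △(0, ·) = -i δ`, and all its time
derivatives at `0` follow.

The operator `𝓑` is moved to the test functions: its transpose `diracTranspose` acts on rows of
test functions, and in Fourier space it is multiplication by a matrix whose square is `-E_p²`, by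
the Clifford relations. By the same relations `D(τ) = (i γ^a ∂_a + m) △(τ, ·)` solves the Dirac
equation `∂_τ D(τ) = D(τ) ∘ diracTranspose` with `D(0) = δ γ⁰` (`hasDerivAt_diracRow`,
`diracRow_zero`), so that its `n`-th derivative at `0` is `𝓑ⁿ δ γ⁰`. The `n`-th derivative is
bounded for all times by a multiple of `∫ E_pⁿ |φ̂|` (`exists_norm_diracRow_iterate_le`), and the
sum of `|τ|ⁿ/n!` times these moments is at most `∫ e^{|τ| E_p} |φ̂|`, which is finite under the
assumption on `φ`. A sharp form of Taylor's theorem (`hasSum_taylor_of_chain`), in which the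
remainder is bounded by the corresponding term of exactly this series, then gives the convergence.
The bounds do not change when `φ` is translated, which allows integration against a second test
function (`hasSum_smearDiff`).

On the functionals `∫ v ψ` of the field, the flow of `H'` is again `diracTranspose`
(`gpbEven_psiFunctional`), and the generalized Dirac bracket with `ψ̄` is pointwise multiplication
by `-i γ⁰` (`gdb_psiFunctional_psibarField`).

For a quantized field, `ψ̄ = ψ† γ⁰` turns the equal-time anticommutators into `A A† + A† A = ‖f‖²`
for the smeared field `A = ψ_l(f)`, so that `‖A‖ ≤ ‖f‖` in `L²`, at all times
(`norm_op_psiField_le`). If `f̂` is supported in a region of bounded energy, Plancherel's theorem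
bounds the `n`-th time derivative of a matrix element of the anticommutator by a multiple of `Rⁿ`.
So the matrix element is the sum of its Taylor series at equal times, which is the series of
brackets summed before (`anticomm_of_bandlimited`). Both sides of the claim are continuous in `f`
with respect to the `L¹` and `L²` norms of `f̂`, for which such `f` are dense.
-/

namespace DiracField

/-! ### Chains of derivatives and Taylor series -/

theorem iteratedDeriv_of_chain {f : ℕ → ℝ → ℂ}
    (hf : ∀ n t, HasDerivAt (f n) (f (n + 1) t) t) (n : ℕ) : iteratedDeriv n (f 0) = f n := by
  induction n with
  | zero => exact iteratedDeriv_zero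
  | succ n ih => rw [iteratedDeriv_succ, ih]; exact funext fun t => (hf n t).deriv

theorem contDiff_of_chain {f : ℕ → ℝ → ℂ}
    (hf : ∀ n t, HasDerivAt (f n) (f (n + 1) t) t) : ContDiff ℝ (⊤ : ℕ∞) (f 0) := by
  refine contDiff_of_differentiable_iteratedDeriv fun n _ => ?_
  rw [iteratedDeriv_of_chain hf n]
  exact fun t => (hf n t).differentiableAt

/-- Taylor's formula with the sharp bound `τⁿ/n! sup |f⁽ⁿ⁾|` on the remainder. -/
theorem norm_sub_taylor_le {K : ℝ} {τ : ℝ} (n : ℕ) {f : ℕ → ℝ → ℂ}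
    (hf : ∀ n t, HasDerivAt (f n) (f (n + 1) t) t) (hK : ∀ t, ‖f n t‖ ≤ K) (hτ : 0 ≤ τ) :
    ‖f 0 τ - ∑ j ∈ Finset.range n, (τ : ℂ) ^ j / (j.factorial : ℂ) * f j 0‖ ≤
      τ ^ n / n.factorial * K := by
  induction n generalizing f τ with
  | zero => simpa using hK τ
  | succ n ih =>
    have hd : ∀ s : ℝ, HasDerivAt
        (fun s : ℝ => f 0 s - ∑ j ∈ Finset.range (n + 1), (s : ℂ) ^ j / (j.factorial : ℂ) * f j 0)
        (f 1 s - ∑ j ∈ Finset.range n, (s : ℂ) ^ j / (j.factorial : ℂ) * f (j + 1) 0) s := by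
      intro s
      refine (hf 0 s).sub ?_
      simp only [Finset.sum_range_succ']
      have : HasDerivAt (fun s : ℝ => ∑ j ∈ Finset.range n,
          (s : ℂ) ^ (j + 1) / ((j + 1).factorial : ℂ) * f (j + 1) 0)
          (∑ j ∈ Finset.range n, (s : ℂ) ^ j / (j.factorial : ℂ) * f (j + 1) 0) s := by
        refine HasDerivAt.fun_sum fun j _ => HasDerivAt.mul_const ?_ _
        have h := (((hasDerivAt_id (s : ℂ)).pow (j + 1)).comp_ofReal).div_const
          ((j + 1).factorial : ℂ)
        refine h.congr_deriv ?_
        have : ((j + 1 : ℕ) : ℂ) ≠ 0 := Nat.cast_ne_zero.mpr j.succ_ne_zero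
        have h2 : (j.factorial : ℂ) ≠ 0 := Nat.cast_ne_zero.mpr j.factorial_ne_zero
        rw [Nat.factorial_succ]
        push_cast at this ⊢
        simp only [id]
        field_simp
      simpa using this.add_const (f 0 0)
    have hB : ∀ s : ℝ, HasDerivAt (fun s : ℝ => s ^ (n + 1) / (n + 1).factorial * K)
        (s ^ n / n.factorial * K) s := by
      intro s
      refine HasDerivAt.mul_const ?_ _
      refine ((hasDerivAt_pow (n + 1) s).div_const _).congr_deriv ?_
      have h2 : (n.factorial : ℝ) ≠ 0 := Nat.cast_ne_zero.mpr n.factorial_ne_zero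
      rw [Nat.factorial_succ]
      push_cast
      field_simp
    refine image_norm_le_of_norm_deriv_right_le_deriv_boundary (a := 0) (b := τ)
      (fun s _ => (hd s).continuousAt.continuousWithinAt) (fun s _ => (hd s).hasDerivWithinAt)
      ?_ hB (fun s hs => ih (f := fun n => f (n + 1)) (fun n t => hf (n + 1) t) hK hs.1)
      (Set.right_mem_Icc.mpr hτ)
    simp [Finset.sum_range_succ']

/-- The Taylor series of `f 0` at `0` converges to `f 0 τ` as soon as the bounds `K n` on the
derivatives `f n` make `∑ |τ|ⁿ/n! K n` finite, with no room to spare in `τ`: the `n`-th remainder is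
at most the `n`-th term of this series. -/
theorem hasSum_taylor_of_chain {f : ℕ → ℝ → ℂ}
    (hf : ∀ n t, HasDerivAt (f n) (f (n + 1) t) t) {K : ℕ → ℝ} (hK : ∀ n t, ‖f n t‖ ≤ K n)
    {τ : ℝ} (hs : Summable fun n : ℕ => |τ| ^ n / n.factorial * K n) :
    HasSum (fun n : ℕ => (τ : ℂ) ^ n / (n.factorial : ℂ) * f n 0) (f 0 τ) := by
  wlog hτ : 0 ≤ τ generalizing f τ
  · have := this (f := fun n t => (-1) ^ n * f n (-t)) (τ := -τ) (fun n t => by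
        have h := ((hf n (-t)).scomp t (hasDerivAt_neg t)).const_mul ((-1 : ℂ) ^ n)
        refine h.congr_deriv ?_
        rw [neg_one_smul, pow_succ]
        ring) (fun n t => by simpa using hK n (-t)) (by simpa using hs) (by linarith)
    simp only [neg_neg, pow_zero, one_mul, neg_zero] at this
    refine this.congr_fun fun n => ?_
    push_cast
    rw [neg_pow (τ : ℂ)]
    have : ((-1 : ℂ) ^ n) * (-1) ^ n = 1 := by rw [← mul_pow]; simp
    linear_combination (-(τ : ℂ) ^ n / (n.factorial : ℂ) * f n 0) * this
  rw [abs_of_nonneg hτ] at hs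
  have hsum : Summable fun n : ℕ => (τ : ℂ) ^ n / (n.factorial : ℂ) * f n 0 := by
    refine hs.of_norm_bounded fun n => ?_
    rw [norm_mul, norm_div, norm_pow, Complex.norm_real, Complex.norm_natCast,
      Real.norm_of_nonneg hτ]
    gcongr
    exact hK n 0
  rw [hsum.hasSum_iff_tendsto_nat, ← tendsto_sub_nhds_zero_iff, tendsto_zero_iff_norm_tendsto_zero]
  refine squeeze_zero (fun _ => norm_nonneg _) (fun n => ?_) hs.tendsto_atTop_zero
  rw [norm_sub_rev]
  exact norm_sub_taylor_le n hf (hK n) hτ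

/-! ### The Fourier transform `φ̂(p) = ∫ e^{ip·x} φ(x) d³x` -/

/-- The Fourier transform `φ̂(p) = ∫ e^{ip·x} φ(x) d³x`, as a map of Schwartz functions. -/
noncomputable def fourierHat : 𝓢(Space, ℂ) →L[ℂ] 𝓢(Space, ℂ) :=
  scaleCLM (-(2 * Real.pi)⁻¹) (by simp [Real.pi_ne_zero]) ∘L fourierCLM ℂ 𝓢(Space, ℂ)

theorem fourierHat_apply (φ : 𝓢(Space, ℂ)) (p : Space) :
    fourierHat φ p = 𝓕 φ (-(2 * Real.pi)⁻¹ • p) := rfl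

theorem fourierHat_eq_integral (φ : 𝓢(Space, ℂ)) (p : Space) :
    fourierHat φ p = ∫ x, planeWave p x * φ x :=
  (integral_planeWave (-(2 * Real.pi)⁻¹) (by have := Real.pi_ne_zero; field_simp) φ p).symm

theorem inner_axis (p : Space) (j : Fin 3) : inner ℝ p (axis j) = p j := by
  simp [axis, EuclideanSpace.inner_single_right]

theorem fourierHat_lineDeriv (j : Fin 3) (φ : 𝓢(Space, ℂ)) (p : Space) :
    fourierHat (∂_{axis j} φ) p = -(Complex.I * p j) * fourierHat φ p := by
  have hg : (fun x : Space => inner ℝ x (axis j)).HasTemperateGrowth :=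
    ((innerSL ℝ).flip (axis j)).hasTemperateGrowth
  have hpi : (Real.pi : ℂ) ≠ 0 := by exact_mod_cast Real.pi_ne_zero
  rw [fourierHat_apply, fourierHat_apply, fourier_lineDerivOp_eq, smul_apply,
    smulLeftCLM_apply_apply hg, inner_smul_left, inner_axis]
  simp only [RCLike.conj_to_real, smul_eq_mul, Complex.real_smul]
  push_cast
  field_simp

theorem fourierHat_translate (φ : 𝓢(Space, ℂ)) (x p : Space) :
    fourierHat (compSubConstCLM ℂ (-x) φ) p = planeWave p (-x) * fourierHat φ p := by
  rw [fourierHat_eq_integral, fourierHat_eq_integral, ← integral_const_mul,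
    ← integral_add_right_eq_self _ (-x)]
  congr 1; ext y
  rw [compSubConstCLM_apply, add_sub_cancel_right, ← mul_assoc, planeWave, planeWave, planeWave,
    ← Complex.exp_add, inner_add_right]
  push_cast
  ring_nf

theorem norm_planeWave (p x : Space) : ‖planeWave p x‖ = 1 := by
  rw [planeWave, mul_comm, Complex.norm_exp_ofReal_mul_I]

theorem norm_fourierHat_translate (φ : 𝓢(Space, ℂ)) (x p : Space) :
    ‖fourierHat (compSubConstCLM ℂ (-x) φ) p‖ = ‖fourierHat φ p‖ := by
  rw [fourierHat_translate, norm_mul, norm_planeWave, one_mul]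

theorem integral_comp_scale (h : Space → ℂ) :
    ∫ p, h (-(2 * Real.pi)⁻¹ • p) = (2 * Real.pi) ^ 3 * ∫ p, h p := by
  rw [Measure.integral_comp_smul]
  simp [abs_of_pos Real.pi_pos, mul_pow, mul_comm]

/-- `∫ w φ̂ d³p / (2π)³`, the tempered distribution with Fourier symbol `w`. -/
noncomputable def symbolPairing (w : Space → ℂ) (φ : 𝓢(Space, ℂ)) : ℂ :=
  (((2 * Real.pi) ^ 3)⁻¹ : ℝ) * ∫ p, w p * fourierHat φ p

theorem symbolPairing_one (φ : 𝓢(Space, ℂ)) : symbolPairing 1 φ = φ 0 := by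
  have h1 : ∫ p, 𝓕 φ p = φ 0 := by
    have : 𝓕⁻ (𝓕 φ) 0 = φ 0 := by rw [FourierPair.fourierInv_fourier_eq]
    rw [fourierInv_coe, Real.fourierInv_eq'] at this
    simpa using this
  have hpi : (Real.pi : ℂ) ≠ 0 := by exact_mod_cast Real.pi_ne_zero
  simp only [symbolPairing, Pi.one_apply, one_mul, fourierHat_apply]
  rw [integral_comp_scale (fun p => 𝓕 φ p), h1]
  push_cast
  field_simp

theorem integral_norm_sq_fourierHat (φ : 𝓢(Space, ℂ)) :
    ∫ p, ‖fourierHat φ p‖ ^ 2 = (2 * Real.pi) ^ 3 * ∫ x, ‖φ x‖ ^ 2 := by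
  simp only [fourierHat_apply]
  rw [Measure.integral_comp_smul volume (fun p => ‖𝓕 φ p‖ ^ 2), integral_norm_sq_fourier]
  simp [abs_of_pos Real.pi_pos, mul_pow, mul_comm]

/-! ### Distributions with bounded Fourier symbols -/

theorem symbolPairing_apply_translate_one (φ : 𝓢(Space, ℂ)) (x : Space) :
    symbolPairing 1 (compSubConstCLM ℂ (-x) φ) = φ x := by
  rw [symbolPairing_one, compSubConstCLM_apply, zero_sub, neg_neg]

theorem fourierHat_injective : Function.Injective fourierHat := fun φ ψ h => by
  ext x
  rw [← symbolPairing_apply_translate_one φ, ← symbolPairing_apply_translate_one ψ]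
  simp only [symbolPairing, fourierHat_translate, h]

theorem lineDeriv_comm (j k : Fin 3) (φ : 𝓢(Space, ℂ)) :
    ∂_{axis j} (∂_{axis k} φ) = ∂_{axis k} (∂_{axis j} φ) := by
  apply fourierHat_injective
  ext p
  simp only [fourierHat_lineDeriv]
  ring

theorem integrable_symbol_mul {w : Space → ℂ} (hw : Measurable w) {C : ℝ} (hb : ∀ p, ‖w p‖ ≤ C)
    (ψ : 𝓢(Space, ℂ)) : Integrable fun p => w p * ψ p := by
  refine (ψ.integrable.norm.const_mul C).mono'
    (hw.mul ψ.continuous.measurable).aestronglyMeasurable (.of_forall fun p => ?_)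
  rw [norm_mul]
  gcongr
  exact hb p

theorem norm_symbolPairing_le {w : Space → ℂ} {φ : 𝓢(Space, ℂ)} {h : Space → ℝ}
    (hh : Integrable h) (hb : ∀ᵐ p, ‖w p * fourierHat φ p‖ ≤ h p) :
    ‖symbolPairing w φ‖ ≤ ∫ p, h p := by
  have h1 := norm_integral_le_of_norm_le hh hb
  have h2 : ((2 * Real.pi) ^ 3)⁻¹ ≤ 1 :=
    inv_le_one_of_one_le₀ (one_le_pow₀ (by nlinarith [Real.pi_gt_three]))
  rw [symbolPairing, norm_mul, Complex.norm_real, Real.norm_of_nonneg (by positivity)]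
  calc _ ≤ 1 * ∫ p, h p := by gcongr
    _ = _ := one_mul _

/-- `symbolPairing w` for a bounded measurable symbol `w`, as a linear functional. -/
noncomputable def symbolFunctional (w : Space → ℂ) (hw : Measurable w) (C : ℝ)
    (hb : ∀ p, ‖w p‖ ≤ C) : 𝓢(Space, ℂ) →ₗ[ℂ] ℂ where
  toFun := symbolPairing w
  map_add' φ ψ := by
    rw [symbolPairing, symbolPairing, symbolPairing, ← mul_add,
      ← integral_add (integrable_symbol_mul hw hb _) (integrable_symbol_mul hw hb _)]
    congr 2; ext p; rw [map_add, add_apply, mul_add]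
  map_smul' c φ := by
    rw [RingHom.id_apply, smul_eq_mul, symbolPairing, symbolPairing, mul_left_comm,
      ← integral_const_mul c]
    refine congrArg _ (integral_congr_ae (.of_forall fun p => ?_))
    simp only [map_smul, smul_apply, smul_eq_mul]; ring

theorem symbolFunctional_apply (w : Space → ℂ) (hw : Measurable w) (C : ℝ) (hb : ∀ p, ‖w p‖ ≤ C)
    (φ : 𝓢(Space, ℂ)) : symbolFunctional w hw C hb φ = symbolPairing w φ := rfl

theorem continuous_symbolPairing_translate {w : Space → ℂ} (hw : Measurable w) {C : ℝ}
    (hb : ∀ p, ‖w p‖ ≤ C) (φ : 𝓢(Space, ℂ)) :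
    Continuous fun x => symbolPairing w (compSubConstCLM ℂ (-x) φ) := by
  unfold symbolPairing
  refine continuous_const.mul (continuous_of_dominated
    (fun x => (integrable_symbol_mul hw hb _).aestronglyMeasurable)
    (bound := fun p => C * ‖fourierHat φ p‖) (fun x => .of_forall fun p => ?_)
    ((fourierHat φ).integrable.norm.const_mul C) (.of_forall fun p => ?_))
  · rw [norm_mul, norm_fourierHat_translate]
    gcongr
    exact hb p
  · simp only [fourierHat_translate, planeWave]
    fun_prop

/-! ### The energy -/

theorem energy_nonneg (m : ℝ) (p : Space) : 0 ≤ energy m p := Real.sqrt_nonneg _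

theorem energy_sq (m : ℝ) (p : Space) : energy m p ^ 2 = ‖p‖ ^ 2 + m ^ 2 :=
  Real.sq_sqrt (by positivity)

theorem ofReal_energy_sq (m : ℝ) (p : Space) :
    (energy m p : ℂ) ^ 2 = p 0 ^ 2 + p 1 ^ 2 + p 2 ^ 2 + m ^ 2 := by
  have := energy_sq m p
  rw [EuclideanSpace.norm_sq_eq, Fin.sum_univ_three] at this
  simp only [Real.norm_eq_abs, sq_abs] at this
  exact_mod_cast this

theorem norm_le_energy (m : ℝ) (p : Space) : ‖p‖ ≤ energy m p :=
  Real.le_sqrt_of_sq_le (by nlinarith [sq_nonneg m])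

theorem abs_mass_le_energy (m : ℝ) (p : Space) : |m| ≤ energy m p :=
  Real.le_sqrt_of_sq_le (by rw [sq_abs]; nlinarith [sq_nonneg ‖p‖])

theorem energy_le (m : ℝ) (p : Space) : energy m p ≤ ‖p‖ + |m| :=
  Real.sqrt_le_iff.mpr ⟨by positivity, by
    rw [← sq_abs m]; nlinarith [norm_nonneg p, abs_nonneg m]⟩

theorem energy_pos (m : ℝ) {p : Space} (hp : p ≠ 0) : 0 < energy m p :=
  (norm_pos_iff.mpr hp).trans_le (norm_le_energy m p)

theorem abs_apply_le_energy (m : ℝ) (p : Space) (j : Fin 3) : |p j| ≤ energy m p :=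
  (PiLp.norm_apply_le p j).trans (norm_le_energy m p)

theorem ae_ne_zero : ∀ᵐ p : Space, p ≠ 0 := by simp [ae_iff]

theorem integrable_energy_pow_mul (m : ℝ) (n : ℕ) (ψ : 𝓢(Space, ℂ)) :
    Integrable fun p => energy m p ^ n * ‖ψ p‖ := by
  have h : Integrable fun p => 2 ^ n * (‖p‖ ^ n * ‖ψ p‖ + |m| ^ n * ‖ψ p‖) :=
    ((ψ.integrable_pow_mul volume n).add (ψ.integrable.norm.const_mul _)).const_mul _
  refine h.mono' ((((continuous_energy m).pow n).mul
    ψ.continuous.norm).aestronglyMeasurable) (.of_forall fun p => ?_)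
  have h0 := energy_nonneg m p
  rw [Real.norm_of_nonneg (by positivity), ← add_mul, ← mul_assoc]
  gcongr
  calc energy m p ^ n ≤ (‖p‖ + |m|) ^ n := by gcongr; exact energy_le m p
    _ ≤ 2 ^ (n - 1) * (‖p‖ ^ n + |m| ^ n) := add_pow_le (norm_nonneg p) (abs_nonneg m) n
    _ ≤ _ := by gcongr <;> simp

/-! ### The Pauli-Jordan function and its time derivatives -/

/-- The Klein-Gordon operator `∂_j ∂_j - m²` on test functions. -/
noncomputable def kleinGordonTest (m : ℝ) (φ : 𝓢(Space, ℂ)) : 𝓢(Space, ℂ) :=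
  (∑ j : Fin 3, ∂_{axis j} (∂_{axis j} φ)) - ((m : ℂ) ^ 2) • φ

theorem fourierHat_kleinGordonTest (m : ℝ) (φ : 𝓢(Space, ℂ)) (p : Space) :
    fourierHat (kleinGordonTest m φ) p = -(energy m p : ℂ) ^ 2 * fourierHat φ p := by
  have h := ofReal_energy_sq m p
  simp only [kleinGordonTest, map_sub, map_add, map_smul, sub_apply, smul_apply,
    Fin.sum_univ_three, add_apply, fourierHat_lineDeriv, smul_eq_mul, h]
  linear_combination ((p 0 : ℂ) ^ 2 + p 1 ^ 2 + p 2 ^ 2) * fourierHat φ p * Complex.I_sq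

/-- `-i sin(E_p t) / E_p`, the Fourier symbol of the Pauli-Jordan function. At `E_p = 0`, that is
for `m = 0` at the single point `p = 0`, it has the junk value `0`. -/
noncomputable def sinSymbol (m t : ℝ) (p : Space) : ℂ :=
  -Complex.I * (Real.sin (energy m p * t) / energy m p : ℝ)

/-- `-i cos(E_p t)`, the Fourier symbol of the time derivative of the Pauli-Jordan function. -/
noncomputable def cosSymbol (m t : ℝ) (p : Space) : ℂ :=
  -Complex.I * (Real.cos (energy m p * t) : ℝ)

theorem measurable_sinSymbol (m t : ℝ) : Measurable (sinSymbol m t) := by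
  have := (continuous_energy m).measurable
  unfold sinSymbol
  fun_prop

theorem measurable_cosSymbol (m t : ℝ) : Measurable (cosSymbol m t) := by
  have := (continuous_energy m).measurable
  unfold cosSymbol
  fun_prop

theorem norm_sinSymbol (m t : ℝ) (p : Space) :
    ‖sinSymbol m t p‖ = |Real.sin (energy m p * t)| / energy m p := by
  rw [sinSymbol, norm_mul, norm_neg, Complex.norm_I, one_mul, Complex.norm_real, Real.norm_eq_abs,
    abs_div, abs_of_nonneg (energy_nonneg m p)]

theorem norm_sinSymbol_le (m t : ℝ) (p : Space) : ‖sinSymbol m t p‖ ≤ |t| := by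
  rw [norm_sinSymbol]
  refine div_le_of_le_mul₀ (energy_nonneg m p) (abs_nonneg t) ?_
  refine Real.abs_sin_le_abs.trans ?_
  rw [abs_mul, abs_of_nonneg (energy_nonneg m p), mul_comm]

theorem energy_mul_norm_sinSymbol_le (m t : ℝ) (p : Space) :
    energy m p * ‖sinSymbol m t p‖ ≤ 1 := by
  rw [norm_sinSymbol]
  rcases (energy_nonneg m p).eq_or_lt with h | h
  · simp [← h]
  · rw [mul_div_cancel₀ _ h.ne']
    exact Real.abs_sin_le_one _

theorem norm_cosSymbol_le (m t : ℝ) (p : Space) : ‖cosSymbol m t p‖ ≤ 1 := by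
  rw [cosSymbol, norm_mul, norm_neg, Complex.norm_I, one_mul, Complex.norm_real]
  exact Real.abs_cos_le_one _

/-- The Pauli-Jordan function `△(t, ·)` in terms of its Fourier symbol. -/
noncomputable def sinFunctional (m t : ℝ) : 𝓢(Space, ℂ) →ₗ[ℂ] ℂ :=
  symbolFunctional (sinSymbol m t) (measurable_sinSymbol m t) |t| (norm_sinSymbol_le m t)

/-- The time derivative of the Pauli-Jordan function in terms of its Fourier symbol. -/
noncomputable def cosFunctional (m t : ℝ) : 𝓢(Space, ℂ) →ₗ[ℂ] ℂ :=
  symbolFunctional (cosSymbol m t) (measurable_cosSymbol m t) 1 (norm_cosSymbol_le m t)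

theorem pauliJordan_eq_sinFunctional (m t : ℝ) (φ : 𝓢(Space, ℂ)) :
    pauliJordan m t φ = sinFunctional m t φ := by
  have hd := fun (s : ℝ) (ψ : 𝓢(Space, ℂ)) =>
    (integrable_density_mul m _ (measurable_phase m s) (norm_phase m s) ψ).1
  change pauliJordanIntegral m t φ = symbolPairing (sinSymbol m t) φ
  rw [pauliJordanIntegral_eq]
  simp only [pauliJordanCLM, sub_apply, ContinuousLinearMap.comp_apply, densityCLM_apply]
  change (∫ p, (massShellDensity m p : ℂ) * (phase m (-t) p * fourierHat φ p)) - _ = _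
  -- the second term is brought to the same form by the reflection `p ↦ -p`
  have h2 : ∫ p, (massShellDensity m p : ℂ) * (phase m t p *
      scaleCLM (2 * Real.pi)⁻¹ (by simp [Real.pi_ne_zero]) (𝓕 φ) p) =
      ∫ p, (massShellDensity m p : ℂ) * (phase m t p * fourierHat φ p) := by
    rw [← integral_neg_eq_self]
    congr 1; ext p
    simp [massShellDensity, phase, energy, scaleCLM_apply, fourierHat_apply]
  rw [fourierCLM_apply, h2, ← integral_sub (hd _ _) (hd _ _), symbolPairing, ← integral_const_mul]
  congr 1; ext p
  have hs := Complex.two_sin (energy m p * t : ℂ)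
  have h3 : Complex.exp (Complex.I * energy m p * (-t : ℝ)) -
      Complex.exp (Complex.I * energy m p * t) =
      -2 * Complex.I * Complex.sin (energy m p * t) := by
    have e1 : Complex.I * energy m p * (-t : ℝ) = -(energy m p * t : ℂ) * Complex.I := by
      push_cast; ring
    have e2 : Complex.I * energy m p * t = (energy m p * t : ℂ) * Complex.I := by ring
    rw [e1, e2]
    linear_combination Complex.I * hs + (Complex.exp (-(energy m p * t : ℂ) * Complex.I) -
      Complex.exp ((energy m p * t : ℂ) * Complex.I)) * Complex.I_sq
  rw [← mul_sub, ← sub_mul, phase, phase, h3, sinSymbol, massShellDensity]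
  push_cast
  rcases eq_or_ne (energy m p : ℂ) 0 with h | h
  · simp [h]
  · have hpi : (Real.pi : ℂ) ≠ 0 := by exact_mod_cast Real.pi_ne_zero
    field_simp

theorem hasDerivAt_sinFunctional (m : ℝ) (φ : 𝓢(Space, ℂ)) (t : ℝ) :
    HasDerivAt (fun t => sinFunctional m t φ) (cosFunctional m t φ) t := by
  refine HasDerivAt.const_mul _ (hasDerivAt_integral_of_dominated_loc_of_deriv_le
    (F := fun s p => sinSymbol m s p * fourierHat φ p)
    (F' := fun s p => cosSymbol m s p * fourierHat φ p)
    (bound := fun p => ‖fourierHat φ p‖) Filter.univ_mem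
    (.of_forall fun s => (integrable_symbol_mul (measurable_sinSymbol m s)
      (norm_sinSymbol_le m s) _).aestronglyMeasurable)
    (integrable_symbol_mul (measurable_sinSymbol m t) (norm_sinSymbol_le m t) _)
    (integrable_symbol_mul (measurable_cosSymbol m t)
      (norm_cosSymbol_le m t) _).aestronglyMeasurable
    (.of_forall fun p s _ => ?_) (fourierHat φ).integrable.norm ?_).2
  · rw [norm_mul]
    exact mul_le_of_le_one_left (norm_nonneg _) (norm_cosSymbol_le m s p)
  · filter_upwards [ae_ne_zero] with p hp s _
    have hE := (energy_pos m hp).ne'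
    refine HasDerivAt.mul_const (HasDerivAt.const_mul _ (HasDerivAt.ofReal_comp ?_)) _
    have h := (((hasDerivAt_id s).const_mul (energy m p)).sin).div_const (energy m p)
    refine h.congr_deriv ?_
    simp only [id]
    field_simp

theorem hasDerivAt_cosFunctional (m : ℝ) (φ : 𝓢(Space, ℂ)) (t : ℝ) :
    HasDerivAt (fun t => cosFunctional m t φ) (sinFunctional m t (kleinGordonTest m φ)) t := by
  refine HasDerivAt.const_mul _ (hasDerivAt_integral_of_dominated_loc_of_deriv_le
    (F := fun s p => cosSymbol m s p * fourierHat φ p)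
    (F' := fun s p => sinSymbol m s p * fourierHat (kleinGordonTest m φ) p)
    (bound := fun p => energy m p ^ 1 * ‖fourierHat φ p‖) Filter.univ_mem
    (.of_forall fun s => (integrable_symbol_mul (measurable_cosSymbol m s)
      (norm_cosSymbol_le m s) _).aestronglyMeasurable)
    (integrable_symbol_mul (measurable_cosSymbol m t) (norm_cosSymbol_le m t) _)
    (integrable_symbol_mul (measurable_sinSymbol m t)
      (norm_sinSymbol_le m t) _).aestronglyMeasurable
    (.of_forall fun p s _ => ?_) (integrable_energy_pow_mul m 1 _) ?_).2
  · have h0 := energy_nonneg m p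
    rw [fourierHat_kleinGordonTest, norm_mul, norm_mul, norm_neg, norm_pow, Complex.norm_real,
      Real.norm_of_nonneg h0]
    calc _ = (energy m p * ‖sinSymbol m s p‖) * (energy m p ^ 1 * ‖fourierHat φ p‖) := by ring
      _ ≤ 1 * _ := by gcongr; exact energy_mul_norm_sinSymbol_le m s p
      _ = _ := one_mul _
  · filter_upwards [ae_ne_zero] with p hp s _
    have hE := (energy_pos m hp).ne'
    have h := ((((hasDerivAt_id s).const_mul (energy m p)).cos).ofReal_comp.const_mul
      (-Complex.I)).mul_const (fourierHat φ p)
    refine h.congr_deriv ?_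
    have hE' : (energy m p : ℂ) ≠ 0 := by exact_mod_cast hE
    rw [fourierHat_kleinGordonTest, sinSymbol]
    simp only [id]
    push_cast
    field_simp

theorem sinFunctional_zero (m : ℝ) (φ : 𝓢(Space, ℂ)) : sinFunctional m 0 φ = 0 := by
  simp [sinFunctional, symbolFunctional_apply, symbolPairing, sinSymbol]

theorem cosFunctional_zero (m : ℝ) (φ : 𝓢(Space, ℂ)) :
    cosFunctional m 0 φ = -Complex.I * φ 0 := by
  rw [← symbolPairing_one φ, cosFunctional, symbolFunctional_apply, symbolPairing, symbolPairing,
    mul_left_comm, ← integral_const_mul]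
  simp [cosSymbol, integral_neg, integral_const_mul]

theorem norm_cosFunctional_le (m t : ℝ) (φ : 𝓢(Space, ℂ)) :
    ‖cosFunctional m t φ‖ ≤ ∫ p, ‖fourierHat φ p‖ := by
  refine norm_symbolPairing_le (fourierHat φ).integrable.norm (.of_forall fun p => ?_)
  rw [norm_mul]
  exact mul_le_of_le_one_left (norm_nonneg _) (norm_cosSymbol_le m t p)

theorem norm_sinFunctional_lineDeriv_le (m t : ℝ) (j : Fin 3) (φ : 𝓢(Space, ℂ)) :
    ‖sinFunctional m t (∂_{axis j} φ)‖ ≤ ∫ p, ‖fourierHat φ p‖ := by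
  refine norm_symbolPairing_le (fourierHat φ).integrable.norm (.of_forall fun p => ?_)
  rw [fourierHat_lineDeriv, norm_mul, norm_mul, norm_neg, norm_mul, Complex.norm_I, one_mul,
    Complex.norm_real, Real.norm_eq_abs, ← mul_assoc, mul_comm ‖sinSymbol m t p‖]
  refine mul_le_of_le_one_left (norm_nonneg _) (le_trans ?_ (energy_mul_norm_sinSymbol_le m t p))
  gcongr
  exact abs_apply_le_energy m p j

theorem norm_mass_mul_sinFunctional_le (m t : ℝ) (φ : 𝓢(Space, ℂ)) :
    ‖(m : ℂ) * sinFunctional m t φ‖ ≤ ∫ p, ‖fourierHat φ p‖ := by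
  rw [← smul_eq_mul, ← map_smul]
  refine norm_symbolPairing_le (fourierHat φ).integrable.norm (.of_forall fun p => ?_)
  rw [map_smul, smul_apply, norm_mul, norm_smul, Complex.norm_real, Real.norm_eq_abs, ← mul_assoc,
    mul_comm ‖sinSymbol m t p‖]
  refine mul_le_of_le_one_left (norm_nonneg _) (le_trans ?_ (energy_mul_norm_sinSymbol_le m t p))
  gcongr
  exact abs_mass_le_energy m p

theorem continuous_sinFunctional_translate (m t : ℝ) (φ : 𝓢(Space, ℂ)) :
    Continuous fun x => sinFunctional m t (compSubConstCLM ℂ (-x) φ) :=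
  continuous_symbolPairing_translate (measurable_sinSymbol m t) (norm_sinSymbol_le m t) φ

theorem continuous_cosFunctional_translate (m t : ℝ) (φ : 𝓢(Space, ℂ)) :
    Continuous fun x => cosFunctional m t (compSubConstCLM ℂ (-x) φ) :=
  continuous_symbolPairing_translate (measurable_cosSymbol m t) (norm_cosSymbol_le m t) φ

/-- The successive time derivatives of `△(t, φ)`, by the Klein-Gordon equation. -/
noncomputable def pauliJordanChain (m : ℝ) (φ : 𝓢(Space, ℂ)) (n : ℕ) (t : ℝ) : ℂ :=
  if Even n then sinFunctional m t ((kleinGordonTest m)^[n / 2] φ)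
  else cosFunctional m t ((kleinGordonTest m)^[n / 2] φ)

theorem hasDerivAt_pauliJordanChain (m : ℝ) (φ : 𝓢(Space, ℂ)) (n : ℕ) (t : ℝ) :
    HasDerivAt (pauliJordanChain m φ n) (pauliJordanChain m φ (n + 1) t) t := by
  rcases Nat.even_or_odd' n with ⟨k, rfl | rfl⟩
  · have h : (2 * k + 1) / 2 = k := by omega
    have hf : pauliJordanChain m φ (2 * k) =
        fun t => sinFunctional m t ((kleinGordonTest m)^[k] φ) := by
      ext t; simp [pauliJordanChain]
    rw [hf]
    simpa [pauliJordanChain, Nat.even_add_one, h] using hasDerivAt_sinFunctional m _ t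
  · have h : (2 * k + 1) / 2 = k := by omega
    have h' : (2 * k + 1 + 1) / 2 = k + 1 := by omega
    have hf : pauliJordanChain m φ (2 * k + 1) =
        fun t => cosFunctional m t ((kleinGordonTest m)^[k] φ) := by
      ext t; simp [pauliJordanChain, h]
    rw [hf]
    simpa [pauliJordanChain, Nat.even_add_one, h', Function.iterate_succ_apply'] using
      hasDerivAt_cosFunctional m ((kleinGordonTest m)^[k] φ) t

theorem pauliJordanChain_zero (m : ℝ) (φ : 𝓢(Space, ℂ)) :
    pauliJordanChain m φ 0 = fun t => pauliJordan m t φ := by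
  ext t
  simp [pauliJordanChain, pauliJordan_eq_sinFunctional]

theorem kleinGordon_apply (m : ℝ) (T : 𝓢'(Space, ℂ)) (φ : 𝓢(Space, ℂ)) :
    kleinGordon m T φ = T (kleinGordonTest m φ) := by
  simp [kleinGordon, kleinGordonTest, Fin.sum_univ_three, lineDerivOp_neg]

theorem kleinGordon_iterate_apply (m : ℝ) (k : ℕ) (T : 𝓢'(Space, ℂ)) (φ : 𝓢(Space, ℂ)) :
    (kleinGordon m)^[k] T φ = T ((kleinGordonTest m)^[k] φ) := by
  induction k generalizing φ with
  | zero => rfl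
  | succ k ih => rw [Function.iterate_succ_apply', kleinGordon_apply, ih,
      Function.iterate_succ_apply]

theorem kleinGordon_iterate_delta (m : ℝ) (k : ℕ) (φ : 𝓢(Space, ℂ)) :
    ((kleinGordon m)^[k] (TemperedDistribution.delta 0)) φ =
      Complex.I * iteratedDeriv (2 * k + 1) (fun t : ℝ => pauliJordan m t φ) 0 := by
  have h : (2 * k + 1) / 2 = k := by omega
  rw [← pauliJordanChain_zero, iteratedDeriv_of_chain (hasDerivAt_pauliJordanChain m φ),
    kleinGordon_iterate_apply, TemperedDistribution.delta_apply]
  simp only [pauliJordanChain, Nat.even_add_one, even_two_mul, not_true, if_false, h,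
    cosFunctional_zero]
  linear_combination ((kleinGordonTest m)^[k] φ 0) * Complex.I_sq

/-! ### The Dirac operator on test spinors -/

/-- The transpose of `𝓑` with respect to the pairing of distributions and test functions, acting on
rows of test functions. -/
noncomputable def diracTranspose (γ : Fin 4 → Mat) (m : ℝ) (v : TestSpinor) : TestSpinor := fun l =>
  (∑ j : Fin 3, ∑ i : Fin 4, (γ 0 * γ j.succ) i l • ∂_{axis j} (v i))
    - (Complex.I * m) • ∑ i : Fin 4, γ 0 i l • v i

/-- The componentwise derivative `∂_j v` of a test spinor. -/
noncomputable def spinorDeriv (j : Fin 3) (v : TestSpinor) : TestSpinor := fun i => ∂_{axis j} (v i)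

/-- The row of numbers that a linear functional makes of a test spinor. -/
noncomputable def rowOf (L : 𝓢(Space, ℂ) →ₗ[ℂ] ℂ) (v : TestSpinor) : Fin 4 → ℂ := fun i => L (v i)

theorem rowOf_diracTranspose (γ : Fin 4 → Mat) (m : ℝ) (L : 𝓢(Space, ℂ) →ₗ[ℂ] ℂ)
    (v : TestSpinor) :
    rowOf L (diracTranspose γ m v) =
      (∑ j : Fin 3, Matrix.vecMul (rowOf L (spinorDeriv j v)) (γ 0 * γ j.succ))
        - (Complex.I * m) • Matrix.vecMul (rowOf L v) (γ 0) := by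
  ext l
  simp only [rowOf, diracTranspose, spinorDeriv, Matrix.vecMul, dotProduct, map_sub, map_sum,
    map_smul, smul_eq_mul, Pi.sub_apply, Finset.sum_apply, Pi.smul_apply, mul_comm]

theorem spinorDeriv_diracTranspose (γ : Fin 4 → Mat) (m : ℝ) (j : Fin 3) (v : TestSpinor) :
    spinorDeriv j (diracTranspose γ m v) = diracTranspose γ m (spinorDeriv j v) := by
  ext1 l
  simp only [spinorDeriv, diracTranspose, sub_eq_add_neg, lineDerivOp_add, lineDerivOp_neg,
    lineDerivOp_sum, lineDerivOp_smul, lineDeriv_comm j]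

theorem spinorDeriv_comm (j k : Fin 3) (v : TestSpinor) :
    spinorDeriv j (spinorDeriv k v) = spinorDeriv k (spinorDeriv j v) :=
  funext fun i => lineDeriv_comm j k (v i)

section Clifford

variable {γ : Fin 4 → Mat}

theorem IsDiracMatrices.zero_mul_zero (hγ : IsDiracMatrices γ) : γ 0 * γ 0 = 1 := by
  have h := hγ 0 0
  simp only [Matrix.diagonal_apply_eq, Matrix.cons_val_zero, mul_one, ← two_smul ℂ] at h
  exact smul_right_injective _ (two_ne_zero' ℂ) h

theorem IsDiracMatrices.succ_mul_succ (hγ : IsDiracMatrices γ) (j : Fin 3) :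
    γ j.succ * γ j.succ = -1 := by
  have h := hγ j.succ j.succ
  have hd : (Matrix.diagonal ![1, -1, -1, -1] : Mat) j.succ j.succ = -1 := by
    rw [Matrix.diagonal_apply_eq]; fin_cases j <;> rfl
  rw [hd, ← two_smul ℂ, mul_smul, neg_one_smul] at h
  exact smul_right_injective _ (two_ne_zero' ℂ) h

theorem IsDiracMatrices.anticomm (hγ : IsDiracMatrices γ) {a b : Fin 4} (hab : a ≠ b) :
    γ a * γ b = -(γ b * γ a) := by
  have h := hγ a b
  rw [Matrix.diagonal_apply_ne _ hab, mul_zero, zero_smul] at h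
  exact eq_neg_of_add_eq_zero_left h

theorem IsDiracMatrices.zero_mul_succ_mul_zero (hγ : IsDiracMatrices γ) (j : Fin 3) :
    γ 0 * γ j.succ * γ 0 = -γ j.succ := by
  rw [mul_assoc, hγ.anticomm (Fin.succ_ne_zero j), mul_neg, ← mul_assoc, hγ.zero_mul_zero, one_mul]

end Clifford

/-! ### The Fourier symbol of the Dirac operator -/

/-- The matrix `-i p_j γ⁰ γ^j - i m γ⁰` by which `diracTranspose` acts, from the right, on the
Fourier transform at `p`. -/
noncomputable def diracSymbol (γ : Fin 4 → Mat) (m : ℝ) (p : Space) : Mat :=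
  (∑ j : Fin 3, -(Complex.I * p j) • (γ 0 * γ j.succ)) - (Complex.I * m) • γ 0

theorem diracSymbol_mul_self {γ : Fin 4 → Mat} (hγ : IsDiracMatrices γ) (m : ℝ) (p : Space) :
    diracSymbol γ m p * diracSymbol γ m p = -((energy m p : ℂ) ^ 2) • (1 : Mat) := by
  have hE := ofReal_energy_sq m p
  have hz := hγ.zero_mul_zero
  have h0 : ∀ j : Fin 3, γ 0 * γ j.succ * γ 0 = -γ j.succ := hγ.zero_mul_succ_mul_zero
  have h1 : ∀ j : Fin 3, γ 0 * (γ 0 * γ j.succ) = γ j.succ := fun j => by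
    rw [← mul_assoc, hz, one_mul]
  have h2 : ∀ j k : Fin 3, γ 0 * γ j.succ * (γ 0 * γ k.succ) = -(γ j.succ * γ k.succ) :=
    fun j k => by
    rw [← mul_assoc, h0, neg_mul]
  have h3 := hγ.succ_mul_succ
  have h10 : γ (Fin.succ 1) * γ (Fin.succ 0) = -(γ (Fin.succ 0) * γ (Fin.succ 1)) :=
    hγ.anticomm (by decide)
  have h20 : γ (Fin.succ 2) * γ (Fin.succ 0) = -(γ (Fin.succ 0) * γ (Fin.succ 2)) :=
    hγ.anticomm (by decide)
  have h21 : γ (Fin.succ 2) * γ (Fin.succ 1) = -(γ (Fin.succ 1) * γ (Fin.succ 2)) :=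
    hγ.anticomm (by decide)
  simp only [diracSymbol, Fin.sum_univ_three, mul_add, add_mul, mul_sub, sub_mul, smul_mul_assoc,
    mul_smul_comm, h0, h1, h2, h3, h10, h20, h21, hz, hE]
  match_scalars
  · linear_combination ((p 0 : ℂ) ^ 2 + p 1 ^ 2 + p 2 ^ 2 + m ^ 2) * Complex.I_sq
  all_goals ring

/-- Evaluation of the Fourier transform at `p`. -/
noncomputable def fourierEval (p : Space) : 𝓢(Space, ℂ) →ₗ[ℂ] ℂ where
  toFun φ := fourierHat φ p
  map_add' φ ψ := by rw [map_add, add_apply]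
  map_smul' c φ := by rw [map_smul, smul_apply, RingHom.id_apply]

theorem rowOf_fourierEval_diracTranspose (γ : Fin 4 → Mat) (m : ℝ) (p : Space) (v : TestSpinor) :
    rowOf (fourierEval p) (diracTranspose γ m v) =
      Matrix.vecMul (rowOf (fourierEval p) v) (diracSymbol γ m p) := by
  have h : ∀ j, rowOf (fourierEval p) (spinorDeriv j v) =
      -(Complex.I * p j) • rowOf (fourierEval p) v := fun j =>
    funext fun i => fourierHat_lineDeriv j (v i) p
  simp only [rowOf_diracTranspose, h, diracSymbol, Matrix.vecMul_sub, Matrix.vecMul_sum,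
    Matrix.vecMul_smul, Matrix.smul_vecMul]

theorem rowOf_fourierEval_iterate (γ : Fin 4 → Mat) (m : ℝ) (p : Space) (n : ℕ)
    (v : TestSpinor) :
    rowOf (fourierEval p) ((diracTranspose γ m)^[n] v) =
      Matrix.vecMul (rowOf (fourierEval p) v) (diracSymbol γ m p ^ n) := by
  induction n with
  | zero => simp
  | succ n ih => rw [Function.iterate_succ_apply', rowOf_fourierEval_diracTranspose, ih,
      Matrix.vecMul_vecMul, pow_succ]

theorem fourierHat_iterate_single (γ : Fin 4 → Mat) (m : ℝ) (n : ℕ) (i l : Fin 4)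
    (φ : 𝓢(Space, ℂ)) (p : Space) :
    fourierHat ((diracTranspose γ m)^[n] (Pi.single i φ) l) p =
      fourierHat φ p * (diracSymbol γ m p ^ n) i l := by
  have h := congrFun (rowOf_fourierEval_iterate γ m p n (Pi.single i φ)) l
  have h2 : rowOf (fourierEval p) (Pi.single i φ) = Pi.single i (fourierHat φ p) := by
    ext k
    rcases eq_or_ne k i with rfl | hk
    · simp [rowOf, fourierEval]
    · simp [rowOf, hk]
  rw [h2, Matrix.single_vecMul] at h
  exact h

theorem diracTranspose_diracTranspose {γ : Fin 4 → Mat} (hγ : IsDiracMatrices γ) (m : ℝ)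
    (v : TestSpinor) :
    diracTranspose γ m (diracTranspose γ m v) = fun i => kleinGordonTest m (v i) := by
  ext1 i
  apply fourierHat_injective
  ext p
  have h := congrFun (rowOf_fourierEval_iterate γ m p 2 v) i
  rw [pow_two, diracSymbol_mul_self hγ, Matrix.vecMul_smul, Matrix.vecMul_one] at h
  rw [fourierHat_kleinGordonTest]
  exact h

theorem exists_norm_diracSymbol_pow_le {γ : Fin 4 → Mat} (hγ : IsDiracMatrices γ) (m : ℝ) :
    ∃ C : ℝ, 0 ≤ C ∧ ∀ (n : ℕ) (p : Space) (i l : Fin 4),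
      ‖(diracSymbol γ m p ^ n) i l‖ ≤ C * energy m p ^ n := by
  -- even powers are scalar, so that a single factor suffices as a bound for all odd ones
  set C : Fin 4 → Fin 4 → ℝ := fun i l =>
    1 + ∑ j : Fin 3, ‖(γ 0 * γ j.succ) i l‖ + ‖γ 0 i l‖ with hC
  have hC1 : ∀ i l, 1 ≤ C i l := fun i l => by
    have : 0 ≤ ∑ j : Fin 3, ‖(γ 0 * γ j.succ) i l‖ := Finset.sum_nonneg fun _ _ => norm_nonneg _
    have := norm_nonneg (γ 0 i l)
    simp only [hC]; linarith
  have hC0 : ∀ i l, 0 ≤ C i l := fun i l => zero_le_one.trans (hC1 i l)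
  have hCle : ∀ i l, C i l ≤ ∑ i, ∑ l, C i l := fun i l =>
    (Finset.single_le_sum (fun l _ => hC0 i l) (Finset.mem_univ l)).trans
      (Finset.single_le_sum (f := fun i => ∑ l, C i l)
        (fun i _ => Finset.sum_nonneg fun l _ => hC0 i l) (Finset.mem_univ i))
  refine ⟨∑ i, ∑ l, C i l, Finset.sum_nonneg fun i _ => Finset.sum_nonneg fun l _ => hC0 i l,
    fun n p i l => le_trans ?_ (mul_le_mul_of_nonneg_right (hCle i l)
      (pow_nonneg (energy_nonneg m p) n))⟩
  have hE := energy_nonneg m p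
  have h1 : ‖diracSymbol γ m p i l‖ ≤ C i l * energy m p := by
    simp only [diracSymbol, Matrix.sub_apply, Matrix.sum_apply, Matrix.smul_apply, smul_eq_mul]
    refine (norm_sub_le _ _).trans ((add_le_add (norm_sum_le _ _) le_rfl).trans ?_)
    have h2 : ∀ j : Fin 3, ‖-(Complex.I * (p j : ℂ)) * (γ 0 * γ j.succ) i l‖ ≤
        ‖(γ 0 * γ j.succ) i l‖ * energy m p := fun j => by
      rw [norm_mul, norm_neg, norm_mul, Complex.norm_I, one_mul, Complex.norm_real, mul_comm]
      gcongr
      exact abs_apply_le_energy m p j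
    have h3 : ‖Complex.I * (m : ℂ) * γ 0 i l‖ ≤ ‖γ 0 i l‖ * energy m p := by
      rw [norm_mul, norm_mul, Complex.norm_I, one_mul, Complex.norm_real, mul_comm]
      gcongr
      exact abs_mass_le_energy m p
    refine (add_le_add (Finset.sum_le_sum fun j _ => h2 j) h3).trans ?_
    rw [← Finset.sum_mul, ← add_mul]
    gcongr
    simp only [hC]; linarith
  have hsq : ∀ k : ℕ, diracSymbol γ m p ^ (2 * k) = (-((energy m p : ℂ) ^ 2)) ^ k • (1 : Mat) := by
    intro k
    rw [pow_mul, pow_two, diracSymbol_mul_self hγ, smul_pow, one_pow]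
  have hn : ∀ k : ℕ, ‖(-((energy m p : ℂ) ^ 2)) ^ k‖ = energy m p ^ (2 * k) := fun k => by
    rw [norm_pow, norm_neg, norm_pow, Complex.norm_real, Real.norm_of_nonneg hE, ← pow_mul]
  rcases Nat.even_or_odd' n with ⟨k, rfl | rfl⟩
  · rw [hsq, Matrix.smul_apply, smul_eq_mul, norm_mul, hn, mul_comm]
    gcongr
    refine le_trans ?_ (hC1 i l)
    rw [Matrix.one_apply]
    split_ifs <;> simp
  · rw [pow_succ, hsq, smul_mul_assoc, one_mul, Matrix.smul_apply, smul_eq_mul, norm_mul, hn,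
      pow_succ]
    calc _ ≤ energy m p ^ (2 * k) * (C i l * energy m p) := by gcongr
      _ = _ := by ring

/-! ### The operator `𝓑` on distributions -/

theorem sum_diracB_apply (γ : Fin 4 → Mat) (m : ℝ) (T : MatDistribution) (k : Fin 4)
    (v : TestSpinor) :
    ∑ i, diracB γ m T i k (v i) = ∑ l, T l k (diracTranspose γ m v l) := by
  simp only [diracB, diracTranspose, Fin.sum_univ_three, Fin.sum_univ_four]
  simp
  ring

theorem diracB_iterate_apply (γ : Fin 4 → Mat) (m : ℝ) (T : MatDistribution) (n : ℕ)
    (i k : Fin 4) (φ : 𝓢(Space, ℂ)) :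
    (diracB γ m)^[n] T i k φ = ∑ l, T l k ((diracTranspose γ m)^[n] (Pi.single i φ) l) := by
  have h : ∀ v : TestSpinor, ∑ i, (diracB γ m)^[n] T i k (v i) =
      ∑ l, T l k ((diracTranspose γ m)^[n] v l) := by
    induction n with
    | zero => intro v; rfl
    | succ n ih =>
      intro v
      rw [Function.iterate_succ_apply', Function.iterate_succ_apply, sum_diracB_apply, ih]
  rw [← h, Finset.sum_eq_single i (fun l _ hl => by rw [Pi.single_eq_of_ne hl, map_zero])
    (fun h => absurd (Finset.mem_univ i) h), Pi.single_eq_same]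

theorem diracB_diracB {γ : Fin 4 → Mat} (hγ : IsDiracMatrices γ) (m : ℝ) (T : MatDistribution)
    (i k : Fin 4) : diracB γ m (diracB γ m T) i k = kleinGordon m (T i k) := by
  ext φ
  have h := diracB_iterate_apply γ m T 2 i k φ
  have h2 : (diracTranspose γ m)^[2] (Pi.single i φ) = Pi.single i (kleinGordonTest m φ) := by
    rw [Function.iterate_succ_apply, Function.iterate_one, diracTranspose_diracTranspose hγ]
    ext1 l
    rcases eq_or_ne l i with rfl | hl
    · simp
    · simp [hl, kleinGordonTest, lineDerivOp_zero]
  rw [h2, Finset.sum_eq_single i (fun l _ hl => by rw [Pi.single_eq_of_ne hl, map_zero])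
    (fun h => absurd (Finset.mem_univ i) h), Pi.single_eq_same] at h
  rw [kleinGordon_apply]
  exact h

theorem mulConst_diracB_iterate_delta (γ : Fin 4 → Mat) (m : ℝ) (n : ℕ) (i k : Fin 4)
    (φ : 𝓢(Space, ℂ)) :
    mulConst ((diracB γ m)^[n] deltaMat) (γ 0) i k φ =
      ∑ l, (diracTranspose γ m)^[n] (Pi.single i φ) l 0 * γ 0 l k := by
  have h : ∀ l, (diracB γ m)^[n] deltaMat i l φ =
      (diracTranspose γ m)^[n] (Pi.single i φ) l 0 := fun l => by
    rw [diracB_iterate_apply, Finset.sum_eq_single l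
      (fun k _ hk => by simp [deltaMat, Matrix.diagonal_apply_ne _ hk])
      (fun h => absurd (Finset.mem_univ l) h)]
    simp [deltaMat]
  simp only [mulConst, Fin.sum_univ_four]
  simp [h]
  ring

/-! ### The distribution `(i γ^a ∂_a + m) △(τ, ·)` -/

/-- The row of values of `(i γ^a ∂_a + m) △(τ, ·)` on a row of test functions, in terms of the
functionals `△(τ, ·)` and `∂_0 △(τ, ·)`. -/
noncomputable def diracRow (γ : Fin 4 → Mat) (m τ : ℝ) (v : TestSpinor) : Fin 4 → ℂ :=
  Complex.I • (Matrix.vecMul (rowOf (cosFunctional m τ) v) (γ 0)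
    - ∑ j : Fin 3, Matrix.vecMul (rowOf (sinFunctional m τ) (spinorDeriv j v)) (γ j.succ))
    + (m : ℂ) • rowOf (sinFunctional m τ) v

theorem rowOf_single (L : 𝓢(Space, ℂ) →ₗ[ℂ] ℂ) (i : Fin 4) (φ : 𝓢(Space, ℂ)) :
    rowOf L (Pi.single i φ) = Pi.single i (L φ) := by
  ext k
  rcases eq_or_ne k i with rfl | hk
  · simp [rowOf]
  · simp [rowOf, hk]

theorem spinorDeriv_single (j : Fin 3) (i : Fin 4) (φ : 𝓢(Space, ℂ)) :
    spinorDeriv j (Pi.single i φ) = (Pi.single i (∂_{axis j} φ : 𝓢(Space, ℂ)) : TestSpinor) := by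
  ext1 k
  rcases eq_or_ne k i with rfl | hk
  · simp [spinorDeriv]
  · simp [spinorDeriv, hk, lineDerivOp_zero]

theorem deriv_pauliJordan (m : ℝ) (φ : 𝓢(Space, ℂ)) (τ : ℝ) :
    deriv (fun t : ℝ => pauliJordan m t φ) τ = cosFunctional m τ φ := by
  simp only [pauliJordan_eq_sinFunctional]
  exact (hasDerivAt_sinFunctional m φ τ).deriv

theorem diracPauliJordan_eq_diracRow (γ : Fin 4 → Mat) (m τ : ℝ) (i k : Fin 4)
    (φ : 𝓢(Space, ℂ)) :
    diracPauliJordan γ m τ i k φ = diracRow γ m τ (Pi.single i φ) k := by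
  have h : Pi.single (M := fun _ => ℂ) i (sinFunctional m τ φ) k =
      sinFunctional m τ φ * (1 : Mat) i k := by
    rw [Matrix.one_apply, Pi.single_apply]
    simp [eq_comm]
  simp only [diracPauliJordan, deriv_pauliJordan]
  simp only [diracRow, spinorDeriv_single, rowOf_single,
    TemperedDistribution.lineDerivOp_apply_apply, pauliJordan_eq_sinFunctional,
    Matrix.single_vecMul, Pi.add_apply, Pi.smul_apply, Pi.sub_apply, smul_eq_mul,
    h, map_neg, Matrix.row, Fin.sum_univ_three]
  ring

theorem hasDerivAt_vecMul {r : ℝ → Fin 4 → ℂ} {r' : Fin 4 → ℂ} {t : ℝ} (h : HasDerivAt r r' t)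
    (M : Mat) : HasDerivAt (fun t => Matrix.vecMul (r t) M) (Matrix.vecMul r' M) t :=
  hasDerivAt_pi.2 fun k => HasDerivAt.fun_sum (u := Finset.univ) fun i _ =>
    (hasDerivAt_pi.1 h i).mul_const (M i k)

/-- The Dirac equation for `(i γ^a ∂_a + m) △`: it follows from the Klein-Gordon equation for `△`
and the Clifford relations. -/
theorem hasDerivAt_diracRow {γ : Fin 4 → Mat} (hγ : IsDiracMatrices γ) (m : ℝ) (v : TestSpinor)
    (τ : ℝ) :
    HasDerivAt (fun τ => diracRow γ m τ v) (diracRow γ m τ (diracTranspose γ m v)) τ := by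
  have hC : ∀ w : TestSpinor, HasDerivAt (fun τ => rowOf (cosFunctional m τ) w)
      (rowOf (sinFunctional m τ) fun i => kleinGordonTest m (w i)) τ := fun w =>
    hasDerivAt_pi.2 fun i => hasDerivAt_cosFunctional m (w i) τ
  have hS : ∀ w : TestSpinor, HasDerivAt (fun τ => rowOf (sinFunctional m τ) w)
      (rowOf (cosFunctional m τ) w) τ := fun w =>
    hasDerivAt_pi.2 fun i => hasDerivAt_sinFunctional m (w i) τ
  have hd := (((hasDerivAt_vecMul (hC v) (γ 0)).sub (HasDerivAt.fun_sum (u := Finset.univ)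
    fun (j : Fin 3) _ => hasDerivAt_vecMul (hS (spinorDeriv j v)) (γ j.succ))).const_smul
      Complex.I).add ((hS v).const_smul (m : ℂ))
  refine hd.congr_deriv ?_
  have hK : (rowOf (sinFunctional m τ) fun i => kleinGordonTest m (v i)) =
      (∑ j : Fin 3, rowOf (sinFunctional m τ) (spinorDeriv j (spinorDeriv j v)))
        - ((m : ℂ) ^ 2) • rowOf (sinFunctional m τ) v := by
    ext i
    simp only [rowOf, kleinGordonTest, spinorDeriv, map_sub, map_sum, map_smul, Pi.sub_apply,
      Finset.sum_apply, Pi.smul_apply]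
  have hz := hγ.zero_mul_zero
  have h0 := hγ.zero_mul_succ_mul_zero
  have h1 : ∀ j : Fin 3, γ 0 * γ j.succ * γ j.succ = -γ 0 := fun j => by
    rw [mul_assoc, hγ.succ_mul_succ, mul_neg, mul_one]
  have h2 : ∀ {j k : Fin 3}, k < j →
      γ 0 * γ j.succ * γ k.succ = -(γ 0 * γ k.succ * γ j.succ) := fun h => by
    rw [mul_assoc, hγ.anticomm (by simpa using h.ne'), mul_neg, mul_assoc]
  simp only [diracRow, spinorDeriv_diracTranspose, rowOf_diracTranspose, hK, Fin.sum_univ_three,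
    Matrix.sub_vecMul, Matrix.add_vecMul, Matrix.smul_vecMul, Matrix.vecMul_vecMul, hz, h0, h1,
    h2 (show (0 : Fin 3) < 1 by decide), h2 (show (0 : Fin 3) < 2 by decide),
    h2 (show (1 : Fin 3) < 2 by decide), Matrix.vecMul_neg, Matrix.vecMul_one,
    spinorDeriv_comm 1 0, spinorDeriv_comm 2 0, spinorDeriv_comm 2 1]
  match_scalars <;> ring_nf <;> simp only [Complex.I_sq] <;> ring

theorem hasDerivAt_diracRow_iterate {γ : Fin 4 → Mat} (hγ : IsDiracMatrices γ) (m : ℝ)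
    (v : TestSpinor) (k : Fin 4) (n : ℕ) (τ : ℝ) :
    HasDerivAt (fun τ => diracRow γ m τ ((diracTranspose γ m)^[n] v) k)
      (diracRow γ m τ ((diracTranspose γ m)^[n + 1] v) k) τ := by
  rw [Function.iterate_succ_apply']
  exact hasDerivAt_pi.1 (hasDerivAt_diracRow hγ m _ τ) k

theorem diracRow_zero (γ : Fin 4 → Mat) (m : ℝ) (v : TestSpinor) (k : Fin 4) :
    diracRow γ m 0 v k = ∑ l, v l 0 * γ 0 l k := by
  have hs : ∀ w : TestSpinor, rowOf (sinFunctional m 0) w = 0 := fun w =>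
    funext fun i => sinFunctional_zero m _
  have hc : rowOf (cosFunctional m 0) v = -Complex.I • fun l => v l 0 :=
    funext fun l => cosFunctional_zero m _
  simp only [diracRow, hs, hc, Matrix.zero_vecMul, Finset.sum_const_zero, sub_zero, smul_zero,
    add_zero, Matrix.smul_vecMul, smul_smul, mul_neg, Complex.I_mul_I, neg_neg, one_smul]
  rfl

theorem iterate_diracRow_zero (γ : Fin 4 → Mat) (m : ℝ) (n : ℕ) (i k : Fin 4)
    (φ : 𝓢(Space, ℂ)) :
    diracRow γ m 0 ((diracTranspose γ m)^[n] (Pi.single i φ)) k =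
      mulConst ((diracB γ m)^[n] deltaMat) (γ 0) i k φ := by
  rw [diracRow_zero, mulConst_diracB_iterate_delta]

theorem norm_vecMul_apply_le {r : Fin 4 → ℂ} {B : ℝ} (hr : ∀ i, ‖r i‖ ≤ B) (M : Mat)
    (k : Fin 4) : ‖Matrix.vecMul r M k‖ ≤ (∑ i, ‖M i k‖) * B := by
  rw [Finset.sum_mul, Matrix.vecMul, dotProduct]
  refine (norm_sum_le _ _).trans (Finset.sum_le_sum fun i _ => ?_)
  rw [norm_mul, mul_comm]
  gcongr
  exact hr i

theorem exists_norm_diracRow_le (γ : Fin 4 → Mat) (m : ℝ) :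
    ∃ C : ℝ, 0 ≤ C ∧ ∀ (τ : ℝ) (v : TestSpinor) (k : Fin 4),
      ‖diracRow γ m τ v k‖ ≤ C * ∑ i, ∫ p, ‖fourierHat (v i) p‖ := by
  set c : Fin 4 → ℝ := fun a => ∑ i, ∑ k, ‖γ a i k‖
  have hc : ∀ a k, ∑ i, ‖γ a i k‖ ≤ c a := fun a k => Finset.sum_le_sum fun i _ =>
    Finset.single_le_sum (f := fun k => ‖γ a i k‖) (fun _ _ => norm_nonneg _) (Finset.mem_univ k)
  have hc0 : ∀ a, 0 ≤ c a := fun a =>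
    Finset.sum_nonneg fun i _ => Finset.sum_nonneg fun k _ => norm_nonneg _
  refine ⟨c 0 + ∑ j : Fin 3, c j.succ + 1, by
    have := Finset.sum_nonneg fun (j : Fin 3) (_ : j ∈ Finset.univ) => hc0 j.succ
    have := hc0 0
    linarith, fun τ v k => ?_⟩
  set B := ∑ i, ∫ p, ‖fourierHat (v i) p‖
  have hB0 : 0 ≤ B := Finset.sum_nonneg fun i _ => integral_nonneg fun p => norm_nonneg _
  have hB : ∀ i, ∫ p, ‖fourierHat (v i) p‖ ≤ B := fun i =>
    Finset.single_le_sum (f := fun i => ∫ p, ‖fourierHat (v i) p‖)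
      (fun i _ => integral_nonneg fun p => norm_nonneg _) (Finset.mem_univ i)
  have h1 := (norm_vecMul_apply_le (fun i => (norm_cosFunctional_le m τ (v i)).trans (hB i))
    (γ 0) k).trans (mul_le_mul_of_nonneg_right (hc 0 k) hB0)
  have h2 := fun j : Fin 3 => (norm_vecMul_apply_le
    (fun i => (norm_sinFunctional_lineDeriv_le m τ j (v i)).trans (hB i))
    (γ j.succ) k).trans (mul_le_mul_of_nonneg_right (hc j.succ k) hB0)
  have h3 := (norm_mass_mul_sinFunctional_le m τ (v k)).trans (hB k)
  simp only [diracRow, Pi.add_apply, Pi.smul_apply, Pi.sub_apply, Finset.sum_apply, smul_eq_mul]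
  rw [add_mul, add_mul, one_mul, Finset.sum_mul Finset.univ fun j : Fin 3 => c j.succ]
  refine (norm_add_le _ _).trans (add_le_add ?_ h3)
  rw [norm_mul, Complex.norm_I, one_mul]
  exact (norm_sub_le _ _).trans (add_le_add h1 ((norm_sum_le _ _).trans
    (Finset.sum_le_sum fun j _ => h2 j)))

/-- The time derivatives of `(i γ^a ∂_a + m) △(τ, ·)` are bounded uniformly in time by the moments
of the energy. -/
theorem exists_norm_diracRow_iterate_le {γ : Fin 4 → Mat} (hγ : IsDiracMatrices γ) (m : ℝ) :
    ∃ C : ℝ, 0 ≤ C ∧ ∀ (n : ℕ) (τ : ℝ) (i k : Fin 4) (φ : 𝓢(Space, ℂ)),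
      ‖diracRow γ m τ ((diracTranspose γ m)^[n] (Pi.single i φ)) k‖ ≤
        C * ∫ p, energy m p ^ n * ‖fourierHat φ p‖ := by
  obtain ⟨C, hC0, hC⟩ := exists_norm_diracRow_le γ m
  obtain ⟨D, hD0, hD⟩ := exists_norm_diracSymbol_pow_le hγ m
  refine ⟨C * (4 * D), by positivity, fun n τ i k φ => (hC τ _ k).trans ?_⟩
  rw [mul_assoc]
  gcongr
  have h : ∀ l : Fin 4, ∫ p, ‖fourierHat ((diracTranspose γ m)^[n] (Pi.single i φ) l) p‖ ≤
      D * ∫ p, energy m p ^ n * ‖fourierHat φ p‖ := fun l => by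
    rw [← integral_const_mul]
    refine integral_mono (SchwartzMap.integrable _).norm
      ((integrable_energy_pow_mul m n _).const_mul D) fun p => ?_
    rw [fourierHat_iterate_single, norm_mul, mul_comm, ← mul_assoc]
    gcongr
    exact hD n p i l
  refine (Finset.sum_le_sum fun l _ => h l).trans (le_of_eq ?_)
  rw [Finset.sum_const, Finset.card_univ, Fintype.card_fin, nsmul_eq_mul]
  push_cast
  ring

theorem diracPauliJordan_chain_zero (γ : Fin 4 → Mat) (m : ℝ) (i k : Fin 4) (φ : 𝓢(Space, ℂ)) :
    (fun τ => diracPauliJordan γ m τ i k φ) =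
      fun τ => diracRow γ m τ ((diracTranspose γ m)^[0] (Pi.single i φ)) k :=
  funext fun τ => diracPauliJordan_eq_diracRow γ m τ i k φ

theorem contDiff_diracPauliJordan {γ : Fin 4 → Mat} (hγ : IsDiracMatrices γ) (m : ℝ)
    (i k : Fin 4) (φ : 𝓢(Space, ℂ)) :
    ContDiff ℝ (⊤ : ℕ∞) fun τ : ℝ => diracPauliJordan γ m τ i k φ := by
  rw [diracPauliJordan_chain_zero]
  exact contDiff_of_chain (hasDerivAt_diracRow_iterate hγ m (Pi.single i φ) k)

theorem iteratedDeriv_diracPauliJordan {γ : Fin 4 → Mat} (hγ : IsDiracMatrices γ) (m : ℝ)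
    (n : ℕ) (i k : Fin 4) (φ : 𝓢(Space, ℂ)) :
    iteratedDeriv n (fun τ : ℝ => -Complex.I * diracPauliJordan γ m τ i k φ) 0 =
      -Complex.I * mulConst ((diracB γ m)^[n] deltaMat) (γ 0) i k φ := by
  have h := iteratedDeriv_of_chain
    (f := fun n τ => -Complex.I * diracRow γ m τ ((diracTranspose γ m)^[n] (Pi.single i φ)) k)
    (fun n τ => (hasDerivAt_diracRow_iterate hγ m (Pi.single i φ) k n τ).const_mul _) n
  rw [← iterate_diracRow_zero]
  simp only [diracPauliJordan_eq_diracRow]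
  exact congrFun h 0

/-- `∑ |τ|ⁿ/n! ∫ E_pⁿ |φ̂| ≤ ∫ e^{|τ| E_p} |φ̂| ≤ e^{|τ| |m|} ∫ e^{|τ| |p|} |φ̂|`. -/
theorem summable_energy_moments (m : ℝ) {τ : ℝ} {φ : 𝓢(Space, ℂ)} (h : ExpDecay |τ| φ) :
    Summable fun n : ℕ => |τ| ^ n / n.factorial * ∫ p, energy m p ^ n * ‖fourierHat φ p‖ := by
  have hI : Integrable fun p =>
      Real.exp (|τ| * |m|) * (Real.exp (|τ| * ‖p‖) * ‖fourierHat φ p‖) := by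
    refine ((Integrable.norm h).const_mul (Real.exp (|τ| * |m|))).congr (.of_forall fun p => ?_)
    simp only [norm_mul, Complex.norm_real, Real.norm_of_nonneg (Real.exp_pos _).le,
      fourierHat_eq_integral]
  refine summable_of_sum_le (c := ∫ p, Real.exp (|τ| * |m|) *
    (Real.exp (|τ| * ‖p‖) * ‖fourierHat φ p‖)) (fun n => ?_) (fun s => ?_)
  · have : 0 ≤ ∫ p, energy m p ^ n * ‖fourierHat φ p‖ := integral_nonneg fun p =>
      mul_nonneg (pow_nonneg (energy_nonneg m p) n)
      (norm_nonneg (fourierHat φ p))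
    positivity
  · simp only [← integral_const_mul]
    rw [← integral_finsetSum _ fun n _ => (integrable_energy_pow_mul m n _).const_mul _]
    refine integral_mono (integrable_finsetSum _ fun n _ =>
      (integrable_energy_pow_mul m n _).const_mul _) hI fun p => ?_
    have hE := energy_nonneg m p
    calc ∑ n ∈ s, |τ| ^ n / n.factorial * (energy m p ^ n * ‖fourierHat φ p‖)
        = (∑ n ∈ s, (|τ| * energy m p) ^ n / n.factorial) * ‖fourierHat φ p‖ := by
          rw [Finset.sum_mul]
          refine Finset.sum_congr rfl fun n _ => ?_
          rw [mul_pow]; ring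
      _ ≤ Real.exp (|τ| * energy m p) * ‖fourierHat φ p‖ := by
          gcongr
          rw [Real.exp_eq_exp_ℝ]
          exact sum_le_hasSum s (fun n _ => by positivity)
            (NormedSpace.exp_series_hasSum_exp' (𝕂 := ℝ) (|τ| * energy m p) |>.congr_fun
              fun n => by rw [smul_eq_mul, div_eq_inv_mul])
      _ ≤ Real.exp (|τ| * (‖p‖ + |m|)) * ‖fourierHat φ p‖ := by
          gcongr
          exact energy_le m p
      _ = _ := by rw [mul_add, Real.exp_add]; ring

theorem hasSum_diracRow {γ : Fin 4 → Mat} (hγ : IsDiracMatrices γ) (m : ℝ) {τ : ℝ} (i k : Fin 4)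
    {φ : 𝓢(Space, ℂ)}
    (h : Summable fun n : ℕ => |τ| ^ n / n.factorial * ∫ p, energy m p ^ n * ‖fourierHat φ p‖) :
    HasSum (fun n : ℕ => (τ : ℂ) ^ n / (n.factorial : ℂ) *
      diracRow γ m 0 ((diracTranspose γ m)^[n] (Pi.single i φ)) k)
      (diracPauliJordan γ m τ i k φ) := by
  obtain ⟨C, -, hC⟩ := exists_norm_diracRow_iterate_le hγ m
  rw [diracPauliJordan_eq_diracRow]
  refine hasSum_taylor_of_chain
    (f := fun n τ => diracRow γ m τ ((diracTranspose γ m)^[n] (Pi.single i φ)) k)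
    (hasDerivAt_diracRow_iterate hγ m (Pi.single i φ) k) (fun n t => hC n t i k φ) ?_
  simpa only [mul_left_comm] using h.mul_left C

theorem hasSum_diracB {γ : Fin 4 → Mat} (hγ : IsDiracMatrices γ) (m τ : ℝ) (i k : Fin 4)
    (φ : 𝓢(Space, ℂ)) (h : ExpDecay |τ| φ) :
    HasSum
      (fun n : ℕ => -Complex.I *
        ((τ : ℂ) ^ n / (n.factorial : ℂ) * mulConst ((diracB γ m)^[n] deltaMat) (γ 0) i k φ))
      (-Complex.I * diracPauliJordan γ m τ i k φ) := by
  simp only [← iterate_diracRow_zero]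
  exact (hasSum_diracRow hγ m i k (summable_energy_moments m h)).mul_left _

/-! ### Time evolution and the generalized Dirac bracket -/

/-- The linear functional `∫ ∑ v_l ψ_l d³x` of the field `ψ`. -/
noncomputable def psiFunctional (v : TestSpinor) : LinFun :=
  (0, fun
    | .psi => v
    | .pibar => 0)

theorem psiField_eq (l : Fin 4) (f : 𝓢(Space, ℂ)) : psiField l f = psiFunctional (Pi.single l f) :=
  rfl

theorem gpbEven_psiFunctional (γ : Fin 4 → Mat) (m : ℝ) (v : TestSpinor) :
    gpbEven (psiFunctional v) (hamiltonian γ m) = psiFunctional (diracTranspose γ m v) := by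
  have hpd : ∀ a, pd a 0 = 0 := fun a => by
    cases a
    · rfl
    · exact lineDerivOp_zero _
  refine Prod.ext ?_ ?_
  · funext R l
    simp [gpbEven, psiFunctional, dCol, hpd]
  · funext C k
    cases C
    · simp [gpbEven, psiFunctional, dRow, hamiltonian, quadOf, chi1, multiplier1, multiplier2,
        psibarExpr, Fintype.sum_option, pd, pdSign, diracTranspose, lineDerivOp_zero]
      simp only [Finset.smul_sum, smul_smul]
      abel
    · simp [gpbEven, psiFunctional, dRow, hamiltonian, quadOf, chi1, multiplier1, multiplier2,
        psibarExpr, Fintype.sum_option, pd, lineDerivOp_zero]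

theorem timeDeriv_psiFunctional (γ : Fin 4 → Mat) (m : ℝ) (n : ℕ) (v : TestSpinor) :
    timeDeriv γ m n (psiFunctional v) = psiFunctional ((diracTranspose γ m)^[n] v) := by
  induction n generalizing v with
  | zero => rfl
  | succ n ih =>
    rw [Function.iterate_succ_apply, ← ih]
    simp only [timeDeriv, Function.iterate_succ_apply, gpbEven_psiFunctional]

theorem constraintMatrix_inv {γ : Fin 4 → Mat} (hγ : IsDiracMatrices γ) :
    (constraintMatrix γ)⁻¹ = Matrix.of fun l l' => -Complex.I * γ 0 l' l := by
  apply Matrix.inv_eq_right_inv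
  ext l l'
  have h := congrFun (congrFun hγ.zero_mul_zero l') l
  rw [Matrix.mul_apply] at h ⊢
  rw [show (1 : Mat) l l' = (1 : Mat) l' l by simp [Matrix.one_apply, eq_comm], ← h]
  refine Finset.sum_congr rfl fun k _ => ?_
  simp only [constraintMatrix, Matrix.of_apply]
  linear_combination -(γ 0 k l * γ 0 l' k) * Complex.I_sq

theorem integrable_mul_schwartz (f g : 𝓢(Space, ℂ)) : Integrable fun x => f x * g x :=
  ((pairing (ContinuousLinearMap.mul ℂ ℂ)) f g).integrable

theorem gdb_psiFunctional_psibarField {γ : Fin 4 → Mat} (hγ : IsDiracMatrices γ) (v : TestSpinor)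
    (l : Fin 4) (g : 𝓢(Space, ℂ)) :
    gdb γ (psiFunctional v) (psibarField l g) =
      -Complex.I * ∑ k, γ 0 k l * ∫ x, v k x * g x := by
  have h1 : ∀ k, gpbRowExpr (psiFunctional v) (chi1 γ) k = v k := fun k => by
    simp [gpbRowExpr, psiFunctional, gpbRow, chi1, Fintype.sum_option, pd, Matrix.one_apply]
  have h2 : ∀ k, gpbColExpr (psibarField l g) (chi2 γ) k = -(Pi.single l g : TestSpinor) k :=
    fun k => by
    simp [gpbColExpr, psibarField, gpbCol, chi2, Fintype.sum_option, pd, Matrix.one_apply]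
  have h3 : ∀ k, gpbColExpr (psiFunctional v) (chi2 γ) k = 0 := fun k => by
    simp [gpbColExpr, psiFunctional, gpbCol, chi2, Fintype.sum_option, pd]
  have h4 : gpb (psiFunctional v) (psibarField l g) = 0 := by
    simp [gpb, psiFunctional, psibarField, spinorPairing]
  simp only [gdb, h1, h2, h3, h4, constraintMatrix_inv hγ, Matrix.of_apply, zero_sub]
  rw [Finset.mul_sum, ← Finset.sum_neg_distrib]
  refine Finset.sum_congr rfl fun k _ => ?_
  rw [Finset.sum_eq_single l (fun j _ hj => by simp [hj]) (fun h => absurd (Finset.mem_univ l) h)]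
  simp [integral_neg, mul_assoc]

theorem iterate_translate_apply_zero (γ : Fin 4 → Mat) (m : ℝ) (n : ℕ) (i l : Fin 4)
    (f : 𝓢(Space, ℂ)) (x : Space) :
    (diracTranspose γ m)^[n] (Pi.single i (compSubConstCLM ℂ (-x) f)) l 0 =
      (diracTranspose γ m)^[n] (Pi.single i f) l x := by
  rw [← symbolPairing_one, ← symbolPairing_apply_translate_one]
  simp only [symbolPairing, fourierHat_translate, fourierHat_iterate_single, mul_assoc]

theorem mulConst_diracB_iterate_translate (γ : Fin 4 → Mat) (m : ℝ) (n : ℕ) (i k : Fin 4)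
    (f : 𝓢(Space, ℂ)) (x : Space) :
    mulConst ((diracB γ m)^[n] deltaMat) (γ 0) i k (compSubConstCLM ℂ (-x) f) =
      ∑ l, (diracTranspose γ m)^[n] (Pi.single i f) l x * γ 0 l k := by
  simp only [mulConst_diracB_iterate_delta, iterate_translate_apply_zero]

theorem gdb_timeDeriv {γ : Fin 4 → Mat} (hγ : IsDiracMatrices γ) (m : ℝ) (n : ℕ) (l' l : Fin 4)
    (f g : 𝓢(Space, ℂ)) :
    gdb γ (timeDeriv γ m n (psiField l' f)) (psibarField l g) =
      smearDiff (fun φ => -Complex.I * mulConst ((diracB γ m)^[n] deltaMat) (γ 0) l' l φ) f g := by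
  rw [psiField_eq, timeDeriv_psiFunctional, gdb_psiFunctional_psibarField hγ]
  simp only [smearDiff, mulConst_diracB_iterate_translate, Finset.mul_sum, ← integral_const_mul]
  rw [← integral_finsetSum _ fun k _ =>
    ((integrable_mul_schwartz _ _).const_mul _).const_mul _]
  congr 1; ext x
  refine Finset.sum_congr rfl fun k _ => ?_
  ring

/-- The sum of the Taylor series of `(i γ^a ∂_a + m) △(τ, ·)`, smeared with `f` and `g`: the moment
bounds do not depend on the translation of `f`, so that the sum and the integral over the
translations may be exchanged. -/
theorem hasSum_smearDiff {γ : Fin 4 → Mat} (hγ : IsDiracMatrices γ) (m : ℝ) {τ : ℝ} (l' l : Fin 4)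
    (f g : 𝓢(Space, ℂ))
    (h : Summable fun n : ℕ => |τ| ^ n / n.factorial * ∫ p, energy m p ^ n * ‖fourierHat f p‖) :
    HasSum
      (fun n : ℕ => (τ : ℂ) ^ n / (n.factorial : ℂ) *
        gdb γ (timeDeriv γ m n (psiField l' f)) (psibarField l g))
      (smearDiff (fun φ => -Complex.I * diracPauliJordan γ m τ l' l φ) f g) := by
  obtain ⟨C, hC0, hC⟩ := exists_norm_diracRow_iterate_le hγ m
  set K : ℕ → ℝ := fun n => |τ| ^ n / n.factorial * ∫ p, energy m p ^ n * ‖fourierHat f p‖ with hK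
  have hterm : ∀ n x, g x * (-Complex.I * ((τ : ℂ) ^ n / (n.factorial : ℂ) *
      diracRow γ m 0 ((diracTranspose γ m)^[n] (Pi.single l' (compSubConstCLM ℂ (-x) f))) l)) =
      (τ : ℂ) ^ n / (n.factorial : ℂ) * (g x * (-Complex.I *
        mulConst ((diracB γ m)^[n] deltaMat) (γ 0) l' l (compSubConstCLM ℂ (-x) f))) := by
    intro n x
    rw [iterate_diracRow_zero]
    ring
  have hsum : ∀ x, HasSum (fun n => g x * (-Complex.I * ((τ : ℂ) ^ n / (n.factorial : ℂ) *
      diracRow γ m 0 ((diracTranspose γ m)^[n] (Pi.single l' (compSubConstCLM ℂ (-x) f))) l)))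
      (g x * (-Complex.I * diracPauliJordan γ m τ l' l (compSubConstCLM ℂ (-x) f))) := fun x =>
    ((hasSum_diracRow hγ m l' l (by simpa only [norm_fourierHat_translate] using h)).mul_left
      _).mul_left _
  have hbound : ∀ n x, ‖g x * (-Complex.I * ((τ : ℂ) ^ n / (n.factorial : ℂ) *
      diracRow γ m 0 ((diracTranspose γ m)^[n] (Pi.single l' (compSubConstCLM ℂ (-x) f))) l))‖ ≤
      (C * K n) * ‖g x‖ := fun n x => by
    have hr := hC n 0 l' l (compSubConstCLM ℂ (-x) f)
    simp only [norm_fourierHat_translate] at hr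
    rw [norm_mul, norm_mul, norm_neg, Complex.norm_I, one_mul, norm_mul, norm_div, norm_pow,
      Complex.norm_real, Complex.norm_natCast, Real.norm_eq_abs, mul_comm]
    refine mul_le_mul_of_nonneg_right ?_ (norm_nonneg _)
    refine (mul_le_mul_of_nonneg_left hr (by positivity)).trans (le_of_eq ?_)
    simp only [hK]; ring
  have hI := hasSum_integral_of_dominated_convergence (μ := volume)
    (F := fun n x => g x * (-Complex.I * ((τ : ℂ) ^ n / (n.factorial : ℂ) *
      diracRow γ m 0 ((diracTranspose γ m)^[n] (Pi.single l' (compSubConstCLM ℂ (-x) f))) l)))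
    (fun n x => (C * K n) * ‖g x‖) (fun n => ?_) (fun n => .of_forall (hbound n))
    (.of_forall fun x => (h.mul_left C).mul_right _) ?_ (.of_forall hsum)
  · refine hI.congr_fun fun n => ?_
    rw [gdb_timeDeriv hγ, smearDiff, ← integral_const_mul]
    simp only [hterm]
  · refine Continuous.aestronglyMeasurable ?_
    simp only [hterm, mulConst_diracB_iterate_translate]
    have := g.continuous
    have h2 := fun k => ((diracTranspose γ m)^[n] (Pi.single l' f) k).continuous
    fun_prop
  · simp only [tsum_mul_right]
    exact g.integrable.norm.const_mul _

theorem smearDiff_const_mul (c : ℂ) (T : 𝓢(Space, ℂ) → ℂ) (f g : 𝓢(Space, ℂ)) :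
    smearDiff (fun φ => c * T φ) f g = c * smearDiff T f g := by
  rw [smearDiff, smearDiff, ← integral_const_mul]
  congr 1; ext x; ring

/-! ### Approximation by band-limited test functions -/

theorem fourierHat_surjective : Function.Surjective fourierHat := fun ψ => by
  refine ⟨𝓕⁻ (scaleCLM (-(2 * Real.pi)) (by simp [Real.pi_ne_zero]) ψ), ?_⟩
  ext p
  rw [fourierHat_apply, FourierInvPair.fourier_fourierInv_eq, scaleCLM_apply, smul_smul,
    neg_mul_neg, mul_inv_cancel₀ (by simp [Real.pi_ne_zero]), one_smul]

/-- Every Schwartz function is approximated by functions whose Fourier transform vanishes at high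
energy, with respect to both the `L¹` and the `L²` norm of the Fourier transform. -/
theorem exists_bandlimited_seq (m : ℝ) (f : 𝓢(Space, ℂ)) :
    ∃ F : ℕ → 𝓢(Space, ℂ),
      (∀ N, ∃ R : ℝ, 0 ≤ R ∧ ∀ p, fourierHat (F N) p ≠ 0 → energy m p ≤ R) ∧
      Filter.Tendsto (fun N => ∫ p, ‖fourierHat (f - F N) p‖) Filter.atTop (nhds 0) ∧
      Filter.Tendsto (fun N => ∫ p, ‖fourierHat (f - F N) p‖ ^ 2) Filter.atTop (nhds 0) := by
  let b : ℕ → ContDiffBump (0 : Space) := fun N =>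
    ⟨N + 1, N + 2, by positivity, by linarith⟩
  have hg : ∀ N, (fun p => (b N p : ℂ)).HasTemperateGrowth := fun N =>
    HasCompactSupport.hasTemperateGrowth
      ((b N).hasCompactSupport.comp_left (g := Complex.ofReal) Complex.ofReal_zero)
      (Complex.ofRealCLM.contDiff.comp (b N).contDiff)
  choose F hF using fun N => fourierHat_surjective (smulLeftCLM ℂ (fun p => (b N p : ℂ))
    (fourierHat f))
  have hFp : ∀ N p, fourierHat (F N) p = b N p * fourierHat f p := fun N p => by
    rw [hF, smulLeftCLM_apply_apply (hg N), smul_eq_mul]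
  have hsub : ∀ N p, fourierHat (f - F N) p = ((1 - b N p : ℝ) : ℂ) * fourierHat f p :=
      fun N p => by
    rw [map_sub, sub_apply, hFp]
    push_cast
    ring
  have hle : ∀ N p, ‖fourierHat (f - F N) p‖ ≤ ‖fourierHat f p‖ := fun N p => by
    rw [hsub, norm_mul, Complex.norm_real]
    refine mul_le_of_le_one_left (norm_nonneg _) ?_
    rw [Real.norm_of_nonneg (by linarith [(b N).le_one (x := p)])]
    linarith [(b N).nonneg (x := p)]
  have hev : ∀ p, ∀ᶠ N in Filter.atTop, fourierHat (f - F N) p = 0 := fun p => by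
    obtain ⟨N₀, hN₀⟩ := exists_nat_ge ‖p‖
    filter_upwards [Filter.eventually_ge_atTop N₀] with N hN
    have hN' : (N₀ : ℝ) ≤ N := by exact_mod_cast hN
    have h1 : b N p = 1 := (b N).one_of_mem_closedBall (by
      rw [mem_closedBall_zero_iff]
      change ‖p‖ ≤ (N : ℝ) + 1
      linarith)
    rw [hsub, h1]
    simp
  refine ⟨F, fun N => ⟨(N + 2) + |m|, by positivity, fun p hp => ?_⟩, ?_, ?_⟩
  · refine (energy_le m p).trans (by
      gcongr
      by_contra hlt
      refine hp ?_
      rw [hFp, (b N).zero_of_le_dist (by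
        rw [dist_zero_right]
        exact (not_le.mp hlt).le)]
      simp)
  · rw [show (0 : ℝ) = ∫ _ : Space, (0 : ℝ) by simp]
    refine tendsto_integral_of_dominated_convergence (fun p => ‖fourierHat f p‖)
      (fun N => (fourierHat (f - F N)).continuous.norm.aestronglyMeasurable)
      (fourierHat f).integrable.norm (fun N => .of_forall fun p => ?_) (.of_forall fun p => ?_)
    · rw [norm_norm]; exact hle N p
    · refine tendsto_const_nhds.congr' ?_
      filter_upwards [hev p] with N hN
      rw [hN, norm_zero]
  · rw [show (0 : ℝ) = ∫ _ : Space, (0 : ℝ) by simp]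
    have hI : Integrable fun p => ‖fourierHat f p‖ ^ 2 := by
      refine (integrable_mul_schwartz (fourierHat f) (fourierHat f)).norm.congr
        (.of_forall fun p => ?_)
      simp only [norm_mul, pow_two]
    refine tendsto_integral_of_dominated_convergence (fun p => ‖fourierHat f p‖ ^ 2)
      (fun N => ((fourierHat (f - F N)).continuous.norm.pow 2).aestronglyMeasurable)
      hI (fun N => .of_forall fun p => ?_) (.of_forall fun p => ?_)
    · rw [Real.norm_of_nonneg (by positivity)]
      gcongr
      exact hle N p
    · refine tendsto_const_nhds.congr' ?_
      filter_upwards [hev p] with N hN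
      rw [hN, norm_zero, zero_pow two_ne_zero]

/-! ### Continuity of the smeared right-hand side -/

theorem translate_lineDeriv (x : Space) (j : Fin 3) (f : 𝓢(Space, ℂ)) :
    (∂_{axis j} (compSubConstCLM ℂ (-x) f) : 𝓢(Space, ℂ)) =
      compSubConstCLM ℂ (-x) (∂_{axis j} f) := by
  apply fourierHat_injective
  ext p
  simp only [fourierHat_lineDeriv, fourierHat_translate]
  ring

theorem diracPauliJordan_eq (γ : Fin 4 → Mat) (m τ : ℝ) (i k : Fin 4) (φ : 𝓢(Space, ℂ)) :
    diracPauliJordan γ m τ i k φ =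
      Complex.I * (γ 0 i k * cosFunctional m τ φ
        - ∑ j : Fin 3, γ j.succ i k * sinFunctional m τ (∂_{axis j} φ))
      + m * (1 : Mat) i k * sinFunctional m τ φ := by
  simp only [diracPauliJordan, deriv_pauliJordan]
  simp only [TemperedDistribution.lineDerivOp_apply_apply, pauliJordan_eq_sinFunctional, map_neg,
    mul_neg, Finset.sum_neg_distrib, sub_eq_add_neg]

theorem diracPauliJordan_sub (γ : Fin 4 → Mat) (m τ : ℝ) (i k : Fin 4) (φ ψ : 𝓢(Space, ℂ)) :
    diracPauliJordan γ m τ i k (φ - ψ) =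
      diracPauliJordan γ m τ i k φ - diracPauliJordan γ m τ i k ψ := by
  simp only [diracPauliJordan_eq, sub_eq_add_neg, lineDerivOp_add, lineDerivOp_neg, map_add,
    map_neg, Fin.sum_univ_three]
  ring

theorem continuous_diracPauliJordan_translate (γ : Fin 4 → Mat) (m τ : ℝ) (i k : Fin 4)
    (f : 𝓢(Space, ℂ)) :
    Continuous fun x => diracPauliJordan γ m τ i k (compSubConstCLM ℂ (-x) f) := by
  simp only [diracPauliJordan_eq, translate_lineDeriv]
  have h1 := continuous_cosFunctional_translate m τ f
  have h2 := continuous_sinFunctional_translate m τ f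
  have h3 := fun j : Fin 3 => continuous_sinFunctional_translate m τ (∂_{axis j} f)
  exact (continuous_const.mul ((continuous_const.mul h1).sub
    (continuous_finsetSum _ fun j _ => continuous_const.mul (h3 j)))).add (continuous_const.mul h2)

theorem exists_norm_diracPauliJordan_translate_le {γ : Fin 4 → Mat} (hγ : IsDiracMatrices γ)
    (m : ℝ) :
    ∃ C : ℝ, 0 ≤ C ∧ ∀ (τ : ℝ) (i k : Fin 4) (f : 𝓢(Space, ℂ)) (x : Space),
      ‖diracPauliJordan γ m τ i k (compSubConstCLM ℂ (-x) f)‖ ≤ C * ∫ p, ‖fourierHat f p‖ := by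
  obtain ⟨C, hC0, hC⟩ := exists_norm_diracRow_iterate_le hγ m
  refine ⟨C, hC0, fun τ i k f x => ?_⟩
  have h := hC 0 τ i k (compSubConstCLM ℂ (-x) f)
  simpa only [pow_zero, one_mul, norm_fourierHat_translate, Function.iterate_zero, id,
    ← diracPauliJordan_eq_diracRow] using h

theorem integrable_smearDiff {γ : Fin 4 → Mat} (hγ : IsDiracMatrices γ) (m τ : ℝ) (i k : Fin 4)
    (f g : 𝓢(Space, ℂ)) :
    Integrable fun x => g x * diracPauliJordan γ m τ i k (compSubConstCLM ℂ (-x) f) := by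
  obtain ⟨C, -, hC⟩ := exists_norm_diracPauliJordan_translate_le hγ m
  refine (g.integrable.norm.const_mul (C * ∫ p, ‖fourierHat f p‖)).mono'
    (g.continuous.mul (continuous_diracPauliJordan_translate γ m τ i k f)).aestronglyMeasurable
    (.of_forall fun x => ?_)
  rw [norm_mul, mul_comm]
  gcongr
  exact hC τ i k f x

theorem smearDiff_diracPauliJordan_sub {γ : Fin 4 → Mat} (hγ : IsDiracMatrices γ) (m τ : ℝ)
    (i k : Fin 4) (f f' g : 𝓢(Space, ℂ)) :
    smearDiff (diracPauliJordan γ m τ i k) (f - f') g =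
      smearDiff (diracPauliJordan γ m τ i k) f g - smearDiff (diracPauliJordan γ m τ i k) f' g := by
  simp only [smearDiff]
  rw [← integral_sub (integrable_smearDiff hγ m τ i k f g) (integrable_smearDiff hγ m τ i k f' g)]
  simp only [map_sub, diracPauliJordan_sub, mul_sub]

theorem exists_norm_smearDiff_le {γ : Fin 4 → Mat} (hγ : IsDiracMatrices γ) (m τ : ℝ)
    (i k : Fin 4) (g : 𝓢(Space, ℂ)) :
    ∃ C : ℝ, ∀ f : 𝓢(Space, ℂ),
      ‖smearDiff (diracPauliJordan γ m τ i k) f g‖ ≤ C * ∫ p, ‖fourierHat f p‖ := by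
  obtain ⟨C, -, hC⟩ := exists_norm_diracPauliJordan_translate_le hγ m
  refine ⟨C * ∫ x, ‖g x‖, fun f => ?_⟩
  refine (norm_integral_le_of_norm_le (g.integrable.norm.const_mul (C * ∫ p, ‖fourierHat f p‖))
    (.of_forall fun x => ?_)).trans (le_of_eq ?_)
  · rw [norm_mul, mul_comm]
    gcongr
    exact hC τ i k f x
  · rw [integral_const_mul]; ring

/-! ### The quantized field -/

section Quantized

open ContinuousLinearMap in
theorem norm_le_sqrt_of_anticomm_adjoint {𝓗 : Type*} [NormedAddCommGroup 𝓗]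
    [InnerProductSpace ℂ 𝓗] [CompleteSpace 𝓗] (A : 𝓗 →L[ℂ] 𝓗) (c : ℝ)
    (h : A * adjoint A + adjoint A * A = (c : ℂ) • 1) : ‖A‖ ≤ Real.sqrt c := by
  refine opNorm_le_bound _ (Real.sqrt_nonneg c) fun x => ?_
  have h1 := apply_norm_sq_eq_inner_adjoint_left A x
  have h2 := apply_norm_sq_eq_inner_adjoint_left (adjoint A) x
  rw [adjoint_adjoint] at h2
  have h3 : (A ∘L adjoint A) x + (adjoint A ∘L A) x = (c : ℂ) • x := by
    simpa using congrArg (fun T : 𝓗 →L[ℂ] 𝓗 => T x) h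
  have h4 : ‖adjoint A x‖ ^ 2 + ‖A x‖ ^ 2 = c * ‖x‖ ^ 2 := by
    rw [h1, h2, ← map_add, ← inner_add_left, h3, inner_smul_left, Complex.conj_ofReal,
      inner_self_eq_norm_sq_to_K]
    norm_cast
    exact (RCLike.re_ofReal_mul (K := ℂ) c _).trans (by rw [RCLike.ofReal_re])
  have h5 : ‖A x‖ ^ 2 ≤ c * ‖x‖ ^ 2 := by nlinarith [sq_nonneg ‖adjoint A x‖]
  calc ‖A x‖ ≤ Real.sqrt (c * ‖x‖ ^ 2) := Real.le_sqrt_of_sq_le h5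
    _ = _ := by rw [Real.sqrt_mul' _ (sq_nonneg _), Real.sqrt_sq (norm_nonneg _)]

variable {γ : Fin 4 → Mat} {m : ℝ} {𝓗 : Type*} [NormedAddCommGroup 𝓗] [InnerProductSpace ℂ 𝓗]
  [CompleteSpace 𝓗]

theorem conjTest_apply (f : 𝓢(Space, ℂ)) (x : Space) : conjTest f x = star (f x) := rfl

theorem conjTest_conjTest (f : 𝓢(Space, ℂ)) : conjTest (conjTest f) = f := by
  ext x
  simp [conjTest_apply]

theorem adjoint_op_psiField (hγ : IsDiracMatrices γ) (Q : QuantizedDiracField γ m 𝓗) (t : ℝ)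
    (l : Fin 4) (f : 𝓢(Space, ℂ)) :
    ContinuousLinearMap.adjoint (Q.op t (psiField l f)) =
      ∑ j, γ 0 j l • Q.op t (psibarField j (conjTest f)) := by
  have h : ∀ k, ∑ j, γ 0 j l * γ 0 k j = (1 : Mat) k l := fun k => by
    rw [← hγ.zero_mul_zero, Matrix.mul_apply]
    exact Finset.sum_congr rfl fun j _ => mul_comm _ _
  simp only [Q.dirac_conj, conjTest_conjTest, Finset.smul_sum, smul_smul]
  rw [Finset.sum_comm]
  simp only [← Finset.sum_smul, h, Matrix.one_apply, ite_smul, one_smul, zero_smul,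
    Finset.sum_ite_eq', Finset.mem_univ, if_true]

theorem gdb_psiField_psibarField (hγ : IsDiracMatrices γ) (l j : Fin 4) (f g : 𝓢(Space, ℂ)) :
    gdb γ (psiField l f) (psibarField j g) = -Complex.I * (γ 0 l j * ∫ x, f x * g x) := by
  rw [psiField_eq, gdb_psiFunctional_psibarField hγ, Finset.sum_eq_single l
    (fun k _ hk => by simp [hk]) (fun h => absurd (Finset.mem_univ l) h), Pi.single_eq_same]

/-- The canonical anticommutation relations bound the smeared field by an `L²` norm. -/
theorem norm_op_psiField_le (hγ : IsDiracMatrices γ) (Q : QuantizedDiracField γ m 𝓗) (t : ℝ)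
    (l : Fin 4) (f : 𝓢(Space, ℂ)) :
    ‖Q.op t (psiField l f)‖ ≤ Real.sqrt (∫ p, ‖fourierHat f p‖ ^ 2) := by
  have hc : ‖Q.op t (psiField l f)‖ ≤ Real.sqrt (∫ x, ‖f x‖ ^ 2) := by
    apply norm_le_sqrt_of_anticomm_adjoint
    rw [adjoint_op_psiField hγ, Finset.mul_sum, Finset.sum_mul, ← Finset.sum_add_distrib]
    simp only [mul_smul_comm, smul_mul_assoc, ← smul_add, Q.anticomm, smul_smul,
      gdb_psiField_psibarField hγ, ← Finset.sum_smul]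
    congr 1
    have h1 : ∫ x, f x * conjTest f x = ((∫ x, ‖f x‖ ^ 2 : ℝ) : ℂ) := by
      rw [← integral_complex_ofReal]
      congr 1; ext x
      rw [conjTest_apply, ← starRingEnd_apply, Complex.mul_conj']
      push_cast
      rfl
    have h2 : ∑ j, γ 0 l j * γ 0 j l = 1 := by
      rw [← Matrix.mul_apply, hγ.zero_mul_zero, Matrix.one_apply_eq]
    rw [h1]
    refine Eq.trans ?_ (one_mul _)
    rw [← h2, Finset.sum_mul]
    refine Finset.sum_congr rfl fun j _ => ?_
    linear_combination -(γ 0 l j * γ 0 j l * ((∫ x, ‖f x‖ ^ 2 : ℝ) : ℂ)) * Complex.I_sq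
  refine hc.trans (Real.sqrt_le_sqrt ?_)
  rw [integral_norm_sq_fourierHat]
  exact le_mul_of_one_le_left (integral_nonneg fun x => by positivity)
    (one_le_pow₀ (by nlinarith [Real.pi_gt_three]))

theorem psiFunctional_eq_sum (v : TestSpinor) : psiFunctional v = ∑ l, psiField l (v l) := by
  refine Prod.ext ?_ ?_
  · simp [psiFunctional, psiField, Prod.fst_sum]
  · rw [Prod.snd_sum]
    funext C k
    cases C
    · simp [psiFunctional, psiField, Finset.sum_apply, Pi.single_apply]
    · simp [psiFunctional, psiField, Finset.sum_apply]

theorem sqrt_integral_norm_sq_iterate_le {C R : ℝ} (hR : 0 ≤ R) (hC0 : 0 ≤ C)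
    (hC : ∀ (n : ℕ) (p : Space) (i l : Fin 4), ‖(diracSymbol γ m p ^ n) i l‖ ≤ C * energy m p ^ n)
    {f : 𝓢(Space, ℂ)} (hf : ∀ p, fourierHat f p ≠ 0 → energy m p ≤ R) (n : ℕ) (i l : Fin 4) :
    Real.sqrt (∫ p, ‖fourierHat ((diracTranspose γ m)^[n] (Pi.single i f) l) p‖ ^ 2) ≤
      C * R ^ n * Real.sqrt (∫ p, ‖fourierHat f p‖ ^ 2) := by
  have hI : ∀ φ : 𝓢(Space, ℂ), Integrable fun p => ‖φ p‖ ^ 2 := fun φ =>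
    (integrable_mul_schwartz φ φ).norm.congr (.of_forall fun p => by simp only [norm_mul, pow_two])
  have hCR : 0 ≤ C * R ^ n := by positivity
  rw [← Real.sqrt_sq hCR, ← Real.sqrt_mul (sq_nonneg _), ← integral_const_mul]
  refine Real.sqrt_le_sqrt (integral_mono (hI _) ((hI _).const_mul _) fun p => ?_)
  simp only
  rw [← mul_pow, fourierHat_iterate_single, norm_mul, mul_comm]
  rcases eq_or_ne (fourierHat f p) 0 with h0 | h0
  · simp [h0]
  · gcongr
    refine (hC n p i l).trans ?_
    have := energy_nonneg m p
    gcongr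
    exact hf p h0

/-- The non-equal-time anticommutator for a band-limited test function. Its matrix elements, as
functions of `t`, are the sums of their Taylor series at `t'`, because the evolution is bounded in
`L²` on band-limited functions; the Taylor coefficients are equal-time generalized Dirac
brackets. -/
theorem anticomm_of_bandlimited (hγ : IsDiracMatrices γ) (Q : QuantizedDiracField γ m 𝓗)
    (t t' : ℝ) (l l' : Fin 4) {f : 𝓢(Space, ℂ)} (g : 𝓢(Space, ℂ)) {R : ℝ} (hR : 0 ≤ R)
    (hf : ∀ p, fourierHat f p ≠ 0 → energy m p ≤ R) :
    Q.op t (psiField l f) * Q.op t' (psibarField l' g)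
        + Q.op t' (psibarField l' g) * Q.op t (psiField l f) =
      smearDiff (diracPauliJordan γ m (t - t') l l') f g • (1 : 𝓗 →L[ℂ] 𝓗) := by
  obtain ⟨C, hC0, hC⟩ := exists_norm_diracSymbol_pow_le hγ m
  set B := Q.op t' (psibarField l' g) with hB
  set A : ℕ → ℝ → 𝓗 →L[ℂ] 𝓗 := fun n s =>
    Q.op (t' + s) (psiFunctional ((diracTranspose γ m)^[n] (Pi.single l f))) with hA
  set c := C * Real.sqrt (∫ p, ‖fourierHat f p‖ ^ 2) with hc
  have hAn : ∀ n s, ‖A n s‖ ≤ 4 * c * R ^ n := fun n s => by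
    simp only [hA, psiFunctional_eq_sum, map_sum]
    refine (norm_sum_le _ _).trans ((Finset.sum_le_sum fun k _ =>
      (norm_op_psiField_le hγ Q _ k _).trans
        (sqrt_integral_norm_sq_iterate_le hR hC0 hC hf n l k)).trans (le_of_eq ?_))
    rw [Finset.sum_const, Finset.card_univ, Fintype.card_fin, nsmul_eq_mul, hc]
    push_cast
    ring
  refine ContinuousLinearMap.ext fun w => ext_inner_left ℂ fun u => ?_
  set a : ℕ → ℝ → ℂ := fun n s => inner ℂ u ((A n s * B + B * A n s) w) with ha
  have hchain : ∀ n s, HasDerivAt (a n) (a (n + 1) s) s := fun n s => by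
    have he := fun u' w' => (Q.evolution
      (psiFunctional ((diracTranspose γ m)^[n] (Pi.single l f))) u' w' (t' + s)).comp_const_add t' s
    have h1 := (he u (B w)).add (he (ContinuousLinearMap.adjoint B u) w)
    rw [timeDeriv_psiFunctional, Function.iterate_one, ← Function.iterate_succ_apply' (f :=
      diracTranspose γ m)] at h1
    have hval : ∀ k r, a k r = inner ℂ u (A k r (B w)) +
        inner ℂ (ContinuousLinearMap.adjoint B u) (A k r w) := fun k r => by
      rw [ContinuousLinearMap.adjoint_inner_left, ← inner_add_right]
      rfl
    rw [hval, funext (hval n)]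
    exact h1
  have hbound : ∀ n s, ‖a n s‖ ≤ (‖u‖ * (2 * (4 * c * ‖B‖)) * ‖w‖) * R ^ n := fun n s => by
    have h1 : ‖A n s * B + B * A n s‖ ≤ 2 * (4 * c * R ^ n * ‖B‖) := by
      refine (norm_add_le _ _).trans ?_
      have h2 : ‖A n s * B‖ ≤ 4 * c * R ^ n * ‖B‖ := (norm_mul_le _ _).trans (by
        gcongr; exact hAn n s)
      have h3 : ‖B * A n s‖ ≤ 4 * c * R ^ n * ‖B‖ := (norm_mul_le _ _).trans (by
        rw [mul_comm]; gcongr; exact hAn n s)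
      linarith
    refine (norm_inner_le_norm u _).trans ?_
    refine (mul_le_mul_of_nonneg_left ((ContinuousLinearMap.le_opNorm _ w).trans
      (mul_le_mul_of_nonneg_right h1 (norm_nonneg w))) (norm_nonneg u)).trans (le_of_eq ?_)
    ring
  have hexp : Summable fun n : ℕ => (|t - t'| * R) ^ n / n.factorial :=
    Real.summable_pow_div_factorial _
  have hsum := hasSum_taylor_of_chain hchain hbound (τ := t - t') (by
    refine (hexp.mul_left (‖u‖ * (2 * (4 * c * ‖B‖)) * ‖w‖)).congr fun n => ?_
    rw [mul_pow]; ring)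
  have hmom : Summable fun n : ℕ =>
      |t - t'| ^ n / n.factorial * ∫ p, energy m p ^ n * ‖fourierHat f p‖ := by
    refine (hexp.mul_right (∫ p, ‖fourierHat f p‖)).of_nonneg_of_le (fun n => ?_) fun n => ?_
    · have : 0 ≤ ∫ p, energy m p ^ n * ‖fourierHat f p‖ := integral_nonneg fun p =>
        mul_nonneg (pow_nonneg (energy_nonneg m p) n) (norm_nonneg (fourierHat f p))
      positivity
    · rw [mul_pow, mul_div_right_comm, mul_assoc]
      gcongr
      rw [← integral_const_mul]
      refine integral_mono (integrable_energy_pow_mul m n _)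
        ((fourierHat f).integrable.norm.const_mul _) fun p => ?_
      rcases eq_or_ne (fourierHat f p) 0 with h0 | h0
      · simp [h0]
      · have := energy_nonneg m p
        simp only
        gcongr
        exact hf p h0
  have hrhs := (hasSum_smearDiff hγ m l l' f g hmom).mul_right (Complex.I * inner ℂ u w)
  have heq : a 0 (t - t') = smearDiff (fun φ => -Complex.I * diracPauliJordan γ m (t - t') l l' φ)
      f g * (Complex.I * inner ℂ u w) := by
    refine hsum.unique (hrhs.congr_fun fun n => ?_)
    simp only [ha, hA, hB, add_zero, Q.anticomm, smul_apply, one_apply_eq_self,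
      inner_smul_right, psiField_eq, timeDeriv_psiFunctional]
    ring
  rw [smearDiff_const_mul] at heq
  rw [smul_apply, one_apply_eq_self, inner_smul_right]
  have h0 : a 0 (t - t') =
      inner ℂ u ((Q.op t (psiField l f) * B + B * Q.op t (psiField l f)) w) := by
    simp only [ha, hA, add_sub_cancel, Function.iterate_zero, id, psiField_eq]
  rw [← h0, heq]
  linear_combination -(smearDiff (diracPauliJordan γ m (t - t') l l') f g * inner ℂ u w) *
    Complex.I_sq

theorem psiField_sub (l : Fin 4) (f f' : 𝓢(Space, ℂ)) :
    psiField l (f - f') = psiField l f - psiField l f' := by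
  refine Prod.ext (by simp [psiField]) (funext fun C => ?_)
  cases C
  · exact Pi.single_sub (f := fun _ => 𝓢(Space, ℂ)) l f f'
  · simp [psiField]

theorem anticomm_eq_smearDiff (hγ : IsDiracMatrices γ) (Q : QuantizedDiracField γ m 𝓗)
    (t t' : ℝ) (l l' : Fin 4) (f g : 𝓢(Space, ℂ)) :
    Q.op t (psiField l f) * Q.op t' (psibarField l' g)
        + Q.op t' (psibarField l' g) * Q.op t (psiField l f) =
      smearDiff (diracPauliJordan γ m (t - t') l l') f g • (1 : 𝓗 →L[ℂ] 𝓗) := by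
  obtain ⟨F, hF, hL1, hL2⟩ := exists_bandlimited_seq m f
  obtain ⟨K, hK⟩ := exists_norm_smearDiff_le hγ m (t - t') l l' g
  set B := Q.op t' (psibarField l' g)
  set δ : 𝓢(Space, ℂ) → 𝓗 →L[ℂ] 𝓗 := fun f =>
    Q.op t (psiField l f) * B + B * Q.op t (psiField l f)
      - smearDiff (diracPauliJordan γ m (t - t') l l') f g • 1 with hδ
  have hsub : ∀ N, δ f = δ (f - F N) := fun N => by
    obtain ⟨R, hR, hFR⟩ := hF N
    have h0 : δ (F N) = 0 := sub_eq_zero.mpr (anticomm_of_bandlimited hγ Q t t' l l' g hR hFR)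
    have h1 : δ (f - F N) = δ f - δ (F N) := by
      simp only [hδ, psiField_sub, map_sub, smearDiff_diracPauliJordan_sub hγ, sub_mul, mul_sub,
        sub_smul]
      abel
    rw [h1, h0, sub_zero]
  have hle : ∀ N, ‖δ f‖ ≤ 2 * ‖B‖ * Real.sqrt (∫ p, ‖fourierHat (f - F N) p‖ ^ 2)
      + K * (∫ p, ‖fourierHat (f - F N) p‖) * ‖(1 : 𝓗 →L[ℂ] 𝓗)‖ := fun N => by
    rw [hsub N]
    have h1 := norm_op_psiField_le hγ Q t l (f - F N)
    refine (norm_sub_le _ _).trans (add_le_add ?_ ?_)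
    · have h2 := norm_mul_le (Q.op t (psiField l (f - F N))) B
      have h3 := norm_mul_le B (Q.op t (psiField l (f - F N)))
      refine (norm_add_le _ _).trans ?_
      nlinarith [mul_le_mul_of_nonneg_left h1 (norm_nonneg B)]
    · rw [norm_smul]
      gcongr
      exact hK _
  have hlim : Filter.Tendsto (fun N => 2 * ‖B‖ * Real.sqrt (∫ p, ‖fourierHat (f - F N) p‖ ^ 2)
      + K * (∫ p, ‖fourierHat (f - F N) p‖) * ‖(1 : 𝓗 →L[ℂ] 𝓗)‖) Filter.atTop (nhds 0) := by
    have h := ((hL2.sqrt).const_mul (2 * ‖B‖)).add ((hL1.const_mul K).mul_const ‖(1 : 𝓗 →L[ℂ] 𝓗)‖)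
    simpa using h
  have h0 : ‖δ f‖ ≤ 0 := ge_of_tendsto' hlim hle
  exact sub_eq_zero.mp (norm_le_zero_iff.mp h0)

end Quantized

end DiracField

open DiracField in
theorem theorem2
    (γ : Fin 4 → Mat) (hγ : IsDiracMatrices γ) (m : ℝ) :
    -- smoothness in time of the Pauli-Jordan function, and the lemma
    (∀ φ : 𝓢(Space, ℂ), ContDiff ℝ (⊤ : ℕ∞) fun t : ℝ => pauliJordan m t φ) ∧
    (∀ (k : ℕ) (φ : 𝓢(Space, ℂ)),
      ((kleinGordon m)^[k] (TemperedDistribution.delta 0)) φ =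
        Complex.I * iteratedDeriv (2 * k + 1) (fun t : ℝ => pauliJordan m t φ) 0) ∧
    -- `𝓑² = ∂_j ∂_j - m²`
    (∀ (T : MatDistribution) (i k : Fin 4),
      diracB γ m (diracB γ m T) i k = kleinGordon m (T i k)) ∧
    -- the series is the Taylor series in `τ` of the right-hand side
    (∀ (i k : Fin 4) (φ : 𝓢(Space, ℂ)),
      (ContDiff ℝ (⊤ : ℕ∞) fun τ : ℝ => diracPauliJordan γ m τ i k φ) ∧
      ∀ n : ℕ, iteratedDeriv n (fun τ : ℝ => -Complex.I * diracPauliJordan γ m τ i k φ) 0 =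
        -Complex.I * mulConst ((diracB γ m)^[n] deltaMat) (γ 0) i k φ) ∧
    -- and it converges to the right-hand side
    (∀ (τ : ℝ) (i k : Fin 4) (φ : 𝓢(Space, ℂ)), ExpDecay |τ| φ →
      HasSum
        (fun n : ℕ => -Complex.I *
          ((τ : ℂ) ^ n / (n.factorial : ℂ) * mulConst ((diracB γ m)^[n] deltaMat) (γ 0) i k φ))
        (-Complex.I * diracPauliJordan γ m τ i k φ)) ∧
    -- the terms of the generalized Dirac bracket series
    (∀ (n : ℕ) (l' l : Fin 4) (f g : 𝓢(Space, ℂ)),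
      gdb γ (timeDeriv γ m n (psiField l' f)) (psibarField l g) =
        smearDiff (fun φ => -Complex.I * mulConst ((diracB γ m)^[n] deltaMat) (γ 0) l' l φ) f g) ∧
    -- the sum of the generalized Dirac bracket series
    (∀ (τ : ℝ) (l' l : Fin 4) (f g : 𝓢(Space, ℂ)), ExpDecay |τ| f →
      HasSum
        (fun n : ℕ => (τ : ℂ) ^ n / (n.factorial : ℂ) *
          gdb γ (timeDeriv γ m n (psiField l' f)) (psibarField l g))
        (smearDiff (fun φ => -Complex.I * diracPauliJordan γ m τ l' l φ) f g)) ∧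
    -- the non-equal-time anticommutator
    (∀ (𝓗 : Type*) [NormedAddCommGroup 𝓗] [InnerProductSpace ℂ 𝓗] [CompleteSpace 𝓗]
      (Q : QuantizedDiracField γ m 𝓗) (t t' : ℝ) (l l' : Fin 4) (f g : 𝓢(Space, ℂ)),
      Q.op t (psiField l f) * Q.op t' (psibarField l' g)
          + Q.op t' (psibarField l' g) * Q.op t (psiField l f) =
        smearDiff (fun φ => diracPauliJordan γ m (t - t') l l' φ) f g •
          (1 : 𝓗 →L[ℂ] 𝓗)) := by
  refine ⟨fun φ => ?_, kleinGordon_iterate_delta m, diracB_diracB hγ m, fun i k φ =>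
    ⟨contDiff_diracPauliJordan hγ m i k φ, fun n => iteratedDeriv_diracPauliJordan hγ m n i k φ⟩,
    hasSum_diracB hγ m, gdb_timeDeriv hγ m, fun τ l' l f g h =>
    hasSum_smearDiff hγ m l' l f g (summable_energy_moments m h), ?_⟩
  · rw [← pauliJordanChain_zero]
    exact contDiff_of_chain (hasDerivAt_pauliJordanChain m φ)
  · intro 𝓗 _ _ _ Q t t' l l' f g
    exact anticomm_eq_smearDiff hγ Q t t' l l' f g
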